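/- Let $n\ge 1$, let $\mathbb B=\{z\in\mathbb C^n:|z|<1\}$ and $\mathbb S=\{z\in\mathbb C^n:|z|=1\}$, let $\langle z,w\rangle=\sum_j z_j\overline{w_j}$, and let $V$ be Lebesgue measure on $\mathbb B$ normalized by $V(\mathbb B)=1$. For $a\in\mathbb B\setminus\{0\}$ let $$S_a=\Big\{z\in\mathbb B:\ |a|<|z|<1,\ \Big|1-\Big\langle \frac{z}{|z|},\frac{a}{|a|}\Big\rangle\Big|\le 1-|a|\Big\},$$ and let $S_0=\mathbb B$. Let $\omega$ be a doubling weight, that is, a positive integrable function on $\mathbb B$ with $\omega(z)=\omega(|z|)$ for which there is a constant $C>0$ such that $$\hat\omega(r)<C\,\hat\omega\Big(\frac{1+r}{2}\Big)\quad(0\le r<1),\qquad \hat\omega(r)=\int_r^1\omega(t)\,dt .$$ Write $\omega(E)=\int_E\omega\,dV$, and let $L^p_\omega$ be the space of measurable $f:\mathbb B\to\mathbb C$ with $\|f\|_{L^p_\omega}=(\int_{\mathbb B}|f|^p\omega\,dV)^{1/p}<\infty$. For measurable $\varphi$ put $$M_\omega(\varphi)(z)=\sup_{a\in\mathbb B,\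 z\in S_a}\frac{1}{\omega(S_a)}\int_{S_a}|\varphi|\,\omega\,dV,\qquad z\in\mathbb B .$$ Let $0<p\le q<\infty$ and $\alpha>0$ with $p\alpha>1$. Then for every positive Borel measure $\mu$ on $\mathbb B$, the operator $T_\alpha:f\mapsto[M_\omega(|f|^{1/\alpha})]^\alpha$ is bounded from $L^p_\omega$ to $L^q_\mu$ (that is, it maps $L^p_\omega$ into $L^q_\mu$ and $\|T_\alpha f\|_{L^q_\mu}\le C\|f\|_{L^p_\omega}$ for all $f\in L^p_\omega$, with some $C<\infty$ independent of $f$) if and only if $$\sup_{a\in\mathbb B}\frac{\mu(S_a)}{\omega(S_a)^{q/p}}<\infty .$$ Moreover, there is a constant $K>0$, depending only on $n,p,q,\alpha,\omega$ and not on $\mu$, such that $$K^{-1}\sup_{a\in\mathbb B}\frac{\mu(S_a)}{\omega(S_a)^{q/p}}\ \le\ \|T_\alpha\|^q_{L^p_\omega\to L^q_\mu}\ \le\ K\sup_{a\in\mathbb B}\frac{\mu(S_a)}{\omega(S_a)^{q/p}},$$ where $\|T_\alpha\|_{L^p_\omega\to L^q_\mu}$ is the infimum of all $C\in[0,\infty]$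 with $\|T_\alpha f\|_{L^q_\mu}\le C\|f\|_{L^p_\omega}$ for all $f\in L^p_\omega$. -/

import Mathlib

open MeasureTheory Set Metric
open scoped ENNReal NNReal

noncomputable section

namespace CarlesonBlock

/-- `ℂⁿ` with the Hermitian inner product and the Euclidean norm. -/
abbrev Cn (n : ℕ) : Type := EuclideanSpace ℂ (Fin n)

/-- The open unit ball `𝔹` of `ℂⁿ`. -/
def unitBall (n : ℕ) : Set (Cn n) := ball 0 1

/-- The volume measure `dV` on `𝔹`, normalized by `V(𝔹) = 1`. -/
def normVolume (n : ℕ) : Measure (Cn n) :=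
  (volume (unitBall n))⁻¹ • volume.restrict (unitBall n)

/-- The nonisotropic ball `Q(ξ, r) = {η ∈ 𝕊 : |1 - ⟨ξ, η⟩| ≤ r²}` in the unit sphere. -/
def nonisoBall {n : ℕ} (ξ : Cn n) (r : ℝ) : Set (Cn n) :=
  {η | η ∈ sphere (0 : Cn n) 1 ∧ ‖1 - inner ℂ ξ η‖ ≤ r ^ 2}

open Classical in
/-- The Carleson block `S_a`: the whole ball if `a = 0`, and otherwise the set of all `z ∈ 𝔹` with
`|a| < |z| < 1` and `z / |z| ∈ Q(a / |a|, √(1 - |a|))`. -/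
def block {n : ℕ} (a : Cn n) : Set (Cn n) :=
  if a = 0 then unitBall n
  else {z | z ∈ unitBall n ∧ ‖a‖ < ‖z‖ ∧
    (‖z‖⁻¹ : ℝ) • z ∈ nonisoBall ((‖a‖⁻¹ : ℝ) • a) (Real.sqrt (1 - ‖a‖))}

/-- `ω` is the radial profile of a radial weight on `𝔹`: the function `z ↦ ω(|z|)` is measurable,
positive and integrable on `𝔹`. -/
structure IsRadialWeight (n : ℕ) (ω : ℝ → ℝ) : Prop where
  aemeasurable : AEMeasurable ω (volume.restrict (Ico 0 1))
  pos : ∀ r ∈ Ico (0 : ℝ) 1, 0 < ω r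
  integrable : Integrable (fun z : Cn n => ω ‖z‖) (normVolume n)

/-- `ω̂(r) = ∫_r^1 ω(t) dt`, as an extended nonnegative number. -/
def tail (ω : ℝ → ℝ) (r : ℝ) : ℝ≥0∞ := ∫⁻ t in Ioo r 1, ENNReal.ofReal (ω t)

/-- The class of doubling weights: radial weights with `ω̂(r) < C ω̂((1 + r) / 2)` on `[0, 1)`. -/
structure IsDoublingWeight (n : ℕ) (ω : ℝ → ℝ) : Prop extends IsRadialWeight n ω where
  doubling : ∃ C : ℝ≥0, ∀ r ∈ Ico (0 : ℝ) 1, tail ω r < C * tail ω ((1 + r) / 2)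

/-- The measure `ω dV` on `𝔹`; thus `ω(E) = weightMeasure n ω E`. -/
def weightMeasure (n : ℕ) (ω : ℝ → ℝ) : Measure (Cn n) :=
  (normVolume n).withDensity fun z => ENNReal.ofReal (ω ‖z‖)

/-- The maximal function
`M_ω(φ)(z) = sup_{a ∈ 𝔹, z ∈ S_a} ω(S_a)⁻¹ ∫_{S_a} |φ| ω dV`. -/
def maximalFn {n : ℕ} {F : Type*} [NormedAddCommGroup F] (ω : ℝ → ℝ) (φ : Cn n → F) (z : Cn n) :
    ℝ≥0∞ :=
  ⨆ a ∈ {a : Cn n | a ∈ unitBall n ∧ z ∈ block a},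
    (weightMeasure n ω (block a))⁻¹ * ∫⁻ ξ in block a, ‖φ ξ‖ₑ ∂(weightMeasure n ω)

/-- The nonlinear operator `f ↦ [M_ω(|f|^{1/α})]^α`. -/
def maximalOp {n : ℕ} (ω : ℝ → ℝ) (α : ℝ) (f : Cn n → ℂ) (z : Cn n) : ℝ≥0∞ :=
  (maximalFn ω (fun ξ => ‖f ξ‖ ^ (1 / α)) z) ^ α

/-- `f ∈ L^p_ω`, the Lebesgue space of `ω dV` on the ball. -/
def MemLpWeight {n : ℕ} (ω : ℝ → ℝ) (p : ℝ) (f : Cn n → ℂ) : Prop :=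
  MemLp f (ENNReal.ofReal p) (weightMeasure n ω)

/-- `f ↦ [M_ω(|f|^{1/α})]^α` is bounded from `L^p_ω` to `L^q_μ`; only the part of `μ` on the ball
plays a role. -/
def IsBoundedOp {n : ℕ} (ω : ℝ → ℝ) (μ : Measure (Cn n)) (p q α : ℝ) : Prop :=
  ∃ C : ℝ≥0, ∀ f : Cn n → ℂ, MemLpWeight ω p f →
    MemLp (maximalOp ω α f) (ENNReal.ofReal q) (μ.restrict (unitBall n)) ∧
    eLpNorm (maximalOp ω α f) (ENNReal.ofReal q) (μ.restrict (unitBall n)) ≤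
      C * eLpNorm f (ENNReal.ofReal p) (weightMeasure n ω)

/-- The operator norm of `f ↦ [M_ω(|f|^{1/α})]^α` from `L^p_ω` to `L^q_μ` (possibly `∞`): the
least `C` with `‖[M_ω(|f|^{1/α})]^α‖_{L^q_μ} ≤ C ‖f‖_{L^p_ω}` for all `f ∈ L^p_ω`. -/
def opNorm {n : ℕ} (ω : ℝ → ℝ) (μ : Measure (Cn n)) (p q α : ℝ) : ℝ≥0∞ :=
  sInf {C : ℝ≥0∞ | ∀ f : Cn n → ℂ, MemLpWeight ω p f →
    eLpNorm (maximalOp ω α f) (ENNReal.ofReal q) (μ.restrict (unitBall n)) ≤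
      C * eLpNorm f (ENNReal.ofReal p) (weightMeasure n ω)}

/-- `sup_{a ∈ 𝔹} μ(S_a) / ω(S_a)^{q/p}`. -/
def carlesonSup {n : ℕ} (ω : ℝ → ℝ) (μ : Measure (Cn n)) (p q : ℝ) : ℝ≥0∞ :=
  ⨆ a ∈ unitBall n, μ (block a) / (weightMeasure n ω (block a)) ^ (q / p)

end CarlesonBlock

end

/-! Necessity is a test on the indicator of a block: every average of it over `S_a` itself is `1`,
so the operator is at least `1` on `S_a`, and the norm inequality reads `μ(S_a) ≤ C^q ω(S_a)^(q/p)`.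

For sufficiency put `φ = |f|^(1/α)`, `P = pα > 1` and `s = q/p ≥ 1`. The claim becomes `∫ M(φ)^(sP)
dμ ≲ (∫ φ^P ω dV)^s`, a Carleson embedding for a maximal operator. Blocks behave like balls: `√|1 -
⟨ξ, η⟩|` is a metric on the sphere up to separation, and the weight of a block factors into an
angular and a radial part, both doubling. Hence each block lies in a block of comparable weight that
swallows every block meeting it of at most twice its size (`exists_enlargement`).

Vitali selection then covers `{M(g) > l}` by enlargements of disjoint blocks whose averages exceed
`l`. The Carleson condition and `∑ x_i^s ≤ (∑ x_i)^s` give the weak bound `μ{M(g) > l} ≲ (‖g‖₁ /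
l)^s` (`meas_lt_avgMaximal_le`). Applied at level `t/2` to the part of `φ` above `t/2`, of mass `J`,
it produces `J^s = J^(s-1) J`. Chebyshev bounds `J^(s-1)` by a power of `∫ φ^P`, and the remaining
linear factor is integrated in `t` by the layer cake formula. -/

open scoped Pointwise

/-! ### Nonisotropic geometry of the sphere and volumes of sectors -/

namespace CarlesonBlock

variable {n : ℕ}

/-- The nonisotropic distance `√|1 - ⟨ξ, η⟩|` satisfies the triangle inequality on the sphere. -/
theorem sqrt_norm_one_sub_inner_triangle {ξ η ζ : Cn n} (hξ : ‖ξ‖ = 1) (hη : ‖η‖ = 1)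
    (hζ : ‖ζ‖ = 1) :
    Real.sqrt ‖1 - inner ℂ ξ η‖ ≤ Real.sqrt ‖1 - inner ℂ ξ ζ‖ + Real.sqrt ‖1 - inner ℂ ζ η‖ := by
  have key : ∀ x y : Cn n, ‖x‖ = 1 → ‖y‖ = 1 →
      ‖x - y‖ ≤ Real.sqrt 2 * Real.sqrt ‖1 - inner ℂ x y‖ := by
    intro x y hx hy
    rw [← Real.sqrt_mul (by norm_num)]
    apply Real.le_sqrt_of_sq_le
    have h1 := norm_sub_sq (𝕜 := ℂ) x y
    have h2 : (1 - inner ℂ x y).re ≤ ‖1 - inner ℂ x y‖ := Complex.re_le_norm _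
    simp only [Complex.sub_re, Complex.one_re, RCLike.re_to_complex] at h1 h2
    rw [h1, hx, hy]
    linarith
  -- The cross term is at most `2AB` by Cauchy–Schwarz and `key`, which completes `A² + B²` to the
  -- square `(A + B)²`.
  have hid : (1 - inner ℂ ξ η : ℂ) =
      (1 - inner ℂ ξ ζ) + (1 - inner ℂ ζ η) + inner ℂ (ξ - ζ) (ζ - η) := by
    have : inner ℂ ζ ζ = (1 : ℂ) := by
      rw [inner_self_eq_norm_sq_to_K, hζ]; simp
    rw [inner_sub_left, inner_sub_right, inner_sub_right, this]
    ring
  set A := Real.sqrt ‖1 - inner ℂ ξ ζ‖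
  set B := Real.sqrt ‖1 - inner ℂ ζ η‖
  have hA : A ^ 2 = ‖1 - inner ℂ ξ ζ‖ := Real.sq_sqrt (norm_nonneg _)
  have hB : B ^ 2 = ‖1 - inner ℂ ζ η‖ := Real.sq_sqrt (norm_nonneg _)
  have hA0 : 0 ≤ A := Real.sqrt_nonneg _
  have hB0 : 0 ≤ B := Real.sqrt_nonneg _
  apply Real.sqrt_le_iff.2
  refine ⟨by positivity, ?_⟩
  have h3 : ‖inner ℂ (ξ - ζ) (ζ - η)‖ ≤ 2 * A * B := by
    calc ‖inner ℂ (ξ - ζ) (ζ - η)‖ ≤ ‖ξ - ζ‖ * ‖ζ - η‖ := norm_inner_le_norm _ _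
      _ ≤ (Real.sqrt 2 * A) * (Real.sqrt 2 * B) := by
        gcongr
        · exact key _ _ hξ hζ
        · exact key _ _ hζ hη
      _ = (Real.sqrt 2) ^ 2 * A * B := by ring
      _ = 2 * A * B := by rw [Real.sq_sqrt (by norm_num)]
  calc ‖1 - inner ℂ ξ η‖
      ≤ ‖1 - inner ℂ ξ ζ‖ + ‖1 - inner ℂ ζ η‖ + ‖inner ℂ (ξ - ζ) (ζ - η)‖ := by
        rw [hid]; exact norm_add₃_le
    _ ≤ (A + B) ^ 2 := by rw [← hA, ← hB]; nlinarith

/-- The set of all nonzero `z` whose radial projection lies in the nonisotropic ball of squared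
radius `s` around `ξ`. -/
def sector (ξ : Cn n) (s : ℝ) : Set (Cn n) :=
  {z | z ≠ 0 ∧ ‖(‖z‖ : ℂ) - inner ℂ ξ z‖ ≤ s * ‖z‖}

theorem mem_sector_iff {ξ z : Cn n} {s : ℝ} (hz : z ≠ 0) :
    z ∈ sector ξ s ↔ ‖1 - inner ℂ ξ ((‖z‖⁻¹ : ℝ) • z)‖ ≤ s := by
  have hz' : 0 < ‖z‖ := norm_pos_iff.2 hz
  have h1 : (1 - inner ℂ ξ ((‖z‖⁻¹ : ℝ) • z) : ℂ) =
      ((‖z‖⁻¹ : ℝ) : ℂ) * ((‖z‖ : ℂ) - inner ℂ ξ z) := by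
    rw [inner_smul_right_eq_smul, mul_sub, Complex.real_smul]
    congr 1
    rw [← Complex.ofReal_mul, inv_mul_cancel₀ hz'.ne']
    simp
  rw [h1, norm_mul, Complex.norm_real, Real.norm_of_nonneg (by positivity), sector, mem_ofPred_eq,
    inv_mul_le_iff₀ hz', mul_comm]
  exact ⟨fun h => h.2, fun h => ⟨hz, h⟩⟩

theorem measurableSet_sector (ξ : Cn n) (s : ℝ) : MeasurableSet (sector ξ s) := by
  have h : IsClosed {z : Cn n | ‖(‖z‖ : ℂ) - inner ℂ ξ z‖ ≤ s * ‖z‖} :=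
    isClosed_le (by fun_prop) (by fun_prop)
  exact (measurableSet_singleton (0 : Cn n)).compl.inter h.measurableSet

theorem smul_mem_sector {ξ z : Cn n} {s t : ℝ} (ht : 0 < t) (hz : z ∈ sector ξ s) :
    t • z ∈ sector ξ s := by
  refine ⟨smul_ne_zero ht.ne' hz.1, ?_⟩
  have h1 : ((‖t • z‖ : ℝ) : ℂ) - inner ℂ ξ (t • z) = (t : ℂ) * ((‖z‖ : ℂ) - inner ℂ ξ z) := by
    rw [inner_smul_right_eq_smul, mul_sub, Complex.real_smul, norm_smul,
      Real.norm_of_nonneg ht.le]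
    push_cast
    rfl
  rw [h1, norm_mul, norm_smul, Complex.norm_real, Real.norm_of_nonneg ht.le]
  nlinarith [hz.2]

/-- Sectors are cones because their defining inequality is homogeneous; this is what makes polar
coordinates available on them. -/
theorem smul_sector {ξ : Cn n} {s t : ℝ} (ht : 0 < t) : t • sector ξ s = sector ξ s := by
  ext z
  rw [mem_smul_set_iff_inv_smul_mem₀ ht.ne']
  refine ⟨fun h => ?_, fun h => smul_mem_sector (inv_pos.2 ht) h⟩
  simpa [smul_smul, ht.ne'] using smul_mem_sector ht h

theorem sector_eq_of_two_le {ξ : Cn n} (hξ : ‖ξ‖ = 1) {s : ℝ} (hs : 2 ≤ s) :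
    sector ξ s = {0}ᶜ := by
  ext z
  refine ⟨fun h => h.1, fun h => ⟨h, ?_⟩⟩
  have h1 : ‖inner ℂ ξ z‖ ≤ ‖z‖ := by simpa [hξ] using norm_inner_le_norm (𝕜 := ℂ) ξ z
  calc ‖(‖z‖ : ℂ) - inner ℂ ξ z‖ ≤ ‖(‖z‖ : ℂ)‖ + ‖inner ℂ ξ z‖ := norm_sub_le _ _
    _ ≤ ‖z‖ + ‖z‖ := by gcongr; simp
    _ ≤ s * ‖z‖ := by nlinarith [norm_nonneg z]

/-- The component orthogonal to `ξ`, together with the component along `ξ`, gives the norm. -/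
theorem norm_sq_eq_inner_add {ξ : Cn n} (hξ : ‖ξ‖ = 1) (z : Cn n) :
    ‖z‖ ^ 2 = ‖(inner ℂ ξ z : ℂ)‖ ^ 2 + ‖z - (inner ℂ ξ z : ℂ) • ξ‖ ^ 2 := by
  have horth : inner ℂ ((inner ℂ ξ z : ℂ) • ξ) (z - (inner ℂ ξ z : ℂ) • ξ) = (0 : ℂ) := by
    rw [inner_smul_left, inner_sub_right, inner_smul_right, inner_self_eq_norm_sq_to_K, hξ]
    simp
  have := norm_add_sq_eq_norm_sq_add_norm_sq_of_inner_eq_zero _ _ horth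
  rw [add_sub_cancel, norm_smul, hξ, mul_one] at this
  rw [sq, sq, sq]; exact this

/-- A box adapted to the direction `ξ`. -/
def adaptedBox (ξ : Cn n) (c a b d : ℝ) : Set (Cn n) :=
  {z | |(inner ℂ ξ z : ℂ).re - c| ≤ a ∧ |(inner ℂ ξ z : ℂ).im| ≤ b ∧
    ‖z - (inner ℂ ξ z : ℂ) • ξ‖ ≤ d}

/-- With `u = ⟨z, ξ⟩`, both `|Im u|` and `|z| - |u|` are at most `s|z|`. The squared orthogonal
component is `|z|² - |u|² ≤ 2s`, whence the parabolic scaling `s` against `√s`. -/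
theorem sector_inter_ball_subset_adaptedBox {ξ : Cn n} (hξ : ‖ξ‖ = 1) {s : ℝ} (hs : 0 ≤ s) :
    sector ξ s ∩ unitBall n ⊆ adaptedBox ξ 0 1 s (Real.sqrt (2 * s)) := by
  rintro z ⟨⟨hz0, hz⟩, hz1⟩
  have hz1 : ‖z‖ < 1 := by simpa [unitBall] using hz1
  have hu : ‖inner ℂ ξ z‖ ≤ ‖z‖ := by simpa [hξ] using norm_inner_le_norm (𝕜 := ℂ) ξ z
  have hn := norm_sq_eq_inner_add hξ z
  set u : ℂ := inner ℂ ξ z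
  have h0 := norm_nonneg z
  refine ⟨?_, ?_, ?_⟩
  · rw [sub_zero]; exact (Complex.abs_re_le_norm u).trans (hu.trans hz1.le)
  · have := Complex.abs_im_le_norm ((‖z‖ : ℂ) - u)
    simp only [Complex.sub_im, Complex.ofReal_im, zero_sub, abs_neg] at this
    nlinarith
  · apply Real.le_sqrt_of_sq_le
    have h1 : ‖z‖ - ‖u‖ ≤ s * ‖z‖ := by
      have := norm_sub_norm_le (‖z‖ : ℂ) u
      simp only [Complex.norm_real, norm_norm] at this
      linarith
    have h2 : ‖z‖ ^ 2 - ‖u‖ ^ 2 ≤ (s * ‖z‖) * (2 * ‖z‖) := by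
      nlinarith [norm_nonneg u, mul_nonneg hs h0]
    have h3 : (s * ‖z‖) * (2 * ‖z‖) ≤ 2 * s := by
      have : ‖z‖ * ‖z‖ ≤ 1 := by nlinarith
      nlinarith
    linarith

/-- The centre `3/8` keeps `Re u` in `[1/4, 1/2]`, away from the vertex and from the unit sphere.
Then `|z| - Re u ≤ s/16` and `|Im u| ≤ s/8` add up to less than `s/4 ≤ s|z|`. -/
theorem adaptedBox_subset_sector_inter_ball {ξ : Cn n} (hξ : ‖ξ‖ = 1) {s : ℝ} (hs : 0 < s)
    (hs1 : s ≤ 1) :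
    adaptedBox ξ (3 / 8) (1 / 8) (s / 8) (Real.sqrt s / 8) ⊆ sector ξ s ∩ unitBall n := by
  rintro z ⟨h1, h2, h3⟩
  have hn := norm_sq_eq_inner_add hξ z
  have hu := Complex.sq_norm_sub_sq_re (inner ℂ ξ z : ℂ)
  set u : ℂ := inner ℂ ξ z
  rw [abs_le] at h1
  have h2' : u.im ^ 2 ≤ (s / 8) ^ 2 := by
    rw [← sq_abs]; gcongr
  have h3' : ‖z - u • ξ‖ ^ 2 ≤ s / 64 := by
    calc ‖z - u • ξ‖ ^ 2 ≤ (Real.sqrt s / 8) ^ 2 := by gcongr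
      _ = s / 64 := by rw [div_pow, Real.sq_sqrt hs.le]; norm_num
  have h4 : ‖z‖ ^ 2 - u.re ^ 2 ≤ s / 32 := by nlinarith
  have h4' : 0 ≤ ‖z‖ ^ 2 - u.re ^ 2 := by nlinarith [sq_nonneg u.im, sq_nonneg ‖z - u • ξ‖]
  have h0 := norm_nonneg z
  have hre : 1 / 4 ≤ u.re := by linarith
  have hzu : u.re ≤ ‖z‖ := by nlinarith
  have hz1 : ‖z‖ < 1 := by nlinarith
  refine ⟨⟨?_, ?_⟩, by simpa [unitBall] using hz1⟩
  · rw [← norm_pos_iff]; linarith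
  · have h5 : ‖z‖ - u.re ≤ s / 16 := by nlinarith
    calc ‖(‖z‖ : ℂ) - u‖ ≤ |((‖z‖ : ℂ) - u).re| + |((‖z‖ : ℂ) - u).im| :=
          Complex.norm_le_abs_re_add_abs_im _
      _ = (‖z‖ - u.re) + |u.im| := by
        simp only [Complex.sub_re, Complex.ofReal_re, Complex.sub_im, Complex.ofReal_im, zero_sub,
          abs_neg]
        rw [abs_of_nonneg (by linarith)]
      _ ≤ s * ‖z‖ := by nlinarith

/-- Volumes of boxes are compared through translation invariance and Haar scaling alone, so none has
to be computed. -/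
theorem adaptedBox_subset_smul_vadd {ξ : Cn n} (hξ : ‖ξ‖ = 1) (c a b d : ℝ) {K : ℝ} (hK : 0 < K) :
    adaptedBox ξ 0 (K * a) (K * b) (K * d) ⊆
      K • ((fun z => z + (c : ℂ) • ξ) ⁻¹' adaptedBox ξ c a b d) := by
  intro z hz
  rw [mem_smul_set_iff_inv_smul_mem₀ hK.ne']
  obtain ⟨h1, h2, h3⟩ := hz
  have hξξ : inner ℂ ξ ξ = (1 : ℂ) := by
    rw [inner_self_eq_norm_sq_to_K, hξ]; simp
  have hu : (inner ℂ ξ (K⁻¹ • z + (c : ℂ) • ξ) : ℂ) = ((K⁻¹ : ℝ) : ℂ) * inner ℂ ξ z + c := by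
    rw [inner_add_right, inner_smul_right_eq_smul, inner_smul_right, hξξ, Complex.real_smul]
    simp
  simp only [mem_preimage, adaptedBox, mem_ofPred_eq, hu]
  have hre : (((K⁻¹ : ℝ) : ℂ) * inner ℂ ξ z + c).re = K⁻¹ * (inner ℂ ξ z : ℂ).re + c := by
    simp [-Complex.ofReal_inv]
  have him : (((K⁻¹ : ℝ) : ℂ) * inner ℂ ξ z + c).im = K⁻¹ * (inner ℂ ξ z : ℂ).im := by
    simp [-Complex.ofReal_inv]
  have hw : K⁻¹ • z + (c : ℂ) • ξ - (((K⁻¹ : ℝ) : ℂ) * inner ℂ ξ z + c) • ξ =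
      K⁻¹ • (z - (inner ℂ ξ z : ℂ) • ξ) := by
    rw [← Complex.coe_smul, ← Complex.coe_smul, smul_sub, add_smul, mul_smul]
    abel
  rw [hre, him, hw, norm_smul, Real.norm_of_nonneg (by positivity), add_sub_cancel_right, abs_mul,
    abs_mul, abs_of_pos (inv_pos.2 hK), inv_mul_le_iff₀ hK, inv_mul_le_iff₀ hK, inv_mul_le_iff₀ hK]
  rw [sub_zero] at h1
  exact ⟨h1, h2, h3⟩

/-- Volume of sectors is doubling. -/
theorem volume_sector_le {ξ : Cn n} (hξ : ‖ξ‖ = 1) {s : ℝ} (hs : 0 < s) (hs1 : s ≤ 1) :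
    volume (sector ξ (32 * s) ∩ unitBall n) ≤
      ENNReal.ofReal |(256 : ℝ) ^ Module.finrank ℝ (Cn n)| *
        volume (sector ξ s ∩ unitBall n) := by
  -- The imaginary side forces the factor `256 = 8 · 32`; the other two sides only need `8` and
  -- `64`.
  have hsub : adaptedBox ξ 0 1 (32 * s) (Real.sqrt (2 * (32 * s))) ⊆
      adaptedBox ξ 0 (256 * (1 / 8)) (256 * (s / 8)) (256 * (Real.sqrt s / 8)) := by
    rintro z ⟨h1, h2, h3⟩
    refine ⟨by linarith, by linarith, h3.trans ?_⟩
    rw [show 2 * (32 * s) = 8 ^ 2 * s by ring, Real.sqrt_mul (by norm_num),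
      Real.sqrt_sq (by norm_num)]
    linarith [Real.sqrt_nonneg s]
  calc volume (sector ξ (32 * s) ∩ unitBall n)
      ≤ volume ((256 : ℝ) • ((fun z => z + ((3 / 8 : ℝ) : ℂ) • ξ) ⁻¹'
          adaptedBox ξ (3 / 8) (1 / 8) (s / 8) (Real.sqrt s / 8))) :=
        measure_mono (((sector_inter_ball_subset_adaptedBox hξ (by positivity)).trans hsub).trans
          (adaptedBox_subset_smul_vadd hξ _ _ _ _ (by norm_num)))
    _ = ENNReal.ofReal |(256 : ℝ) ^ Module.finrank ℝ (Cn n)| *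
          volume (adaptedBox ξ (3 / 8) (1 / 8) (s / 8) (Real.sqrt s / 8)) := by
        rw [Measure.addHaar_smul, measure_preimage_add_right]
    _ ≤ _ := by
        gcongr
        exact adaptedBox_subset_sector_inter_ball hξ hs hs1

end CarlesonBlock

/-! ### Polar coordinates and the weight of a block -/

noncomputable section
namespace CarlesonBlock

variable {n : ℕ} {ω : ℝ → ℝ}

theorem block_zero : block (0 : Cn n) = unitBall n := by simp [block]

theorem mem_unitBall {z : Cn n} : z ∈ unitBall n ↔ ‖z‖ < 1 := by simp [unitBall]

theorem block_subset_unitBall (a : Cn n) : block a ⊆ unitBall n := by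
  unfold block
  split_ifs
  · exact subset_rfl
  · exact fun z hz => hz.1

theorem norm_unit_direction {a : Cn n} (ha : a ≠ 0) : ‖(‖a‖⁻¹ : ℝ) • a‖ = 1 := by
  rw [norm_smul, norm_inv, norm_norm, inv_mul_cancel₀ (norm_ne_zero_iff.2 ha)]

theorem block_eq {a : Cn n} (ha : a ≠ 0) (ha1 : ‖a‖ ≤ 1) :
    block a = norm ⁻¹' Ioo ‖a‖ 1 ∩ sector ((‖a‖⁻¹ : ℝ) • a) (1 - ‖a‖) := by
  ext z
  have h0 := norm_nonneg a
  simp only [block, if_neg ha, mem_ofPred_eq, mem_inter_iff, mem_preimage, mem_Ioo, mem_unitBall,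
    nonisoBall]
  constructor
  · rintro ⟨h1, h2, -, h3⟩
    have hz : z ≠ 0 := by rw [← norm_pos_iff]; linarith
    rw [Real.sq_sqrt (by linarith)] at h3
    exact ⟨⟨h2, h1⟩, (mem_sector_iff hz).2 h3⟩
  · rintro ⟨⟨h2, h1⟩, h3⟩
    rw [mem_sector_iff h3.1] at h3
    rw [Real.sq_sqrt (by linarith)]
    have hz : z ≠ 0 := by rw [← norm_pos_iff]; linarith
    exact ⟨h1, h2, by simpa using norm_unit_direction hz, h3⟩

theorem measurableSet_unitBall : MeasurableSet (unitBall n) := measurableSet_ball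

theorem measurableSet_block {a : Cn n} (ha1 : a ∈ unitBall n) : MeasurableSet (block a) := by
  by_cases ha : a = 0
  · rw [ha, block_zero]; exact measurableSet_unitBall
  · rw [block_eq ha (mem_unitBall.1 ha1).le]
    exact (measurable_norm measurableSet_Ioo).inter (measurableSet_sector _ _)

/-- The real dimension of `ℂⁿ`. -/
def realDim (n : ℕ) : ℕ := Module.finrank ℝ (Cn n)

theorem nontrivial_Cn (hn : 1 ≤ n) : Nontrivial (Cn n) := by
  have : Nonempty (Fin n) := ⟨⟨0, hn⟩⟩
  infer_instance

theorem realDim_pos (hn : 1 ≤ n) : 0 < realDim n := by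
  have := nontrivial_Cn hn
  exact Module.finrank_pos

/-- The probability measure `d t^{d-1} dt` on `(0, 1)`, where `d` is the real dimension. -/
def radialMeasure (n : ℕ) : Measure ℝ :=
  (volume.restrict (Ioo 0 1)).withDensity
    fun t => ENNReal.ofReal (realDim n * t ^ (realDim n - 1))

theorem radialMeasure_Iio (hn : 1 ≤ n) {r : ℝ} (h0 : 0 ≤ r) (h1 : r ≤ 1) :
    radialMeasure n (Iio r) = ENNReal.ofReal (r ^ realDim n) := by
  have hd := realDim_pos hn
  set d := realDim n with hd'
  rw [radialMeasure, withDensity_apply _ measurableSet_Iio,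
    Measure.restrict_restrict measurableSet_Iio,
    show Iio r ∩ Ioo 0 1 = Ioo 0 r by
      ext t; simp only [mem_inter_iff, mem_Iio, mem_Ioo]
      exact ⟨fun h => ⟨h.2.1, h.1⟩, fun h => ⟨h.2, h.1, h.2.trans_le h1⟩⟩,
    Measure.restrict_congr_set Ioo_ae_eq_Ioc, ← ofReal_integral_eq_lintegral_ofReal]
  · rw [← intervalIntegral.integral_of_le h0, intervalIntegral.integral_const_mul, integral_pow,
      ← hd', Nat.sub_add_cancel hd, zero_pow hd.ne', Nat.cast_sub (by omega : 1 ≤ d)]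
    congr 1
    have : (d : ℝ) ≠ 0 := by positivity
    push_cast
    rw [sub_add_cancel, sub_zero]
    field_simp
  · change IntegrableOn _ (Ioc 0 r) volume
    rw [← intervalIntegrable_iff_integrableOn_Ioc_of_le h0]
    exact Continuous.intervalIntegrable (by fun_prop) _ _
  · filter_upwards [ae_restrict_mem measurableSet_Ioc] with t ht
    have := ht.1
    positivity

theorem radialMeasure_of_Iio_subset (hn : 1 ≤ n) {S : Set ℝ} (hS : MeasurableSet S)
    (h1 : Iio 1 ⊆ S) : radialMeasure n S = 1 := by
  have h2 : radialMeasure n S = radialMeasure n (Iio 1) := by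
    rw [radialMeasure, withDensity_apply _ hS, withDensity_apply _ measurableSet_Iio,
      Measure.restrict_restrict hS, Measure.restrict_restrict measurableSet_Iio]
    congr 2
    ext t; simp only [mem_inter_iff, mem_Iio, mem_Ioo]
    exact ⟨fun h => ⟨h.2.2, h.2⟩, fun h => ⟨h1 h.1, h.2⟩⟩
  rw [h2, radialMeasure_Iio hn zero_le_one le_rfl]; simp

/-- Polar coordinates on a sector. -/
theorem map_norm_volume_sector (hn : 1 ≤ n) (ξ : Cn n) (s : ℝ) :
    Measure.map norm (volume.restrict (sector ξ s ∩ unitBall n)) =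
      volume (sector ξ s ∩ unitBall n) • radialMeasure n := by
  have hfin : volume (sector ξ s ∩ unitBall n) ≠ ∞ :=
    ((measure_mono inter_subset_right).trans_lt measure_ball_lt_top).ne
  have hms := (measurableSet_sector ξ s).inter (measurableSet_unitBall (n := n))
  have : IsFiniteMeasure (Measure.map norm
      (volume.restrict (sector ξ s ∩ unitBall n)) : Measure ℝ) := by
    have : IsFiniteMeasure (volume.restrict (sector ξ s ∩ unitBall n)) :=
      ⟨by rw [Measure.restrict_apply_univ]; exact hfin.lt_top⟩
    infer_instance
  have hmap : ∀ r : ℝ, Measure.map norm (volume.restrict (sector ξ s ∩ unitBall n)) (Iio r) =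
      volume (ball 0 r ∩ (sector ξ s ∩ unitBall n)) := by
    intro r
    rw [Measure.map_apply measurable_norm measurableSet_Iio,
      Measure.restrict_apply (measurable_norm measurableSet_Iio)]
    congr 2
    ext z; simp
  -- Because a sector is a cone, its part in the ball of radius `r` is a dilate of its part in the
  -- unit ball, of relative volume `r^d`. The half-lines `Iio r` form a π-system, so this determines
  -- the measure.
  have hsmall : ∀ r : ℝ, 0 < r → r ≤ 1 → ball 0 r ∩ (sector ξ s ∩ unitBall n) =
      r • (sector ξ s ∩ unitBall n) := by
    intro r hr hr1
    rw [smul_set_inter₀ hr.ne', smul_sector hr, unitBall, smul_unitBall hr.ne',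
      Real.norm_of_nonneg hr.le, inter_left_comm,
      inter_eq_left.2 (ball_subset_ball hr1)]
  refine ext_of_generate_finite _ (BorelSpace.measurable_eq.trans (borel_eq_generateFrom_Iio ℝ))
    isPiSystem_Iio ?_ ?_
  swap
  · rw [Measure.map_apply measurable_norm MeasurableSet.univ, Measure.smul_apply,
      radialMeasure_of_Iio_subset hn MeasurableSet.univ (subset_univ _)]
    simp
  rintro _ ⟨r, rfl⟩
  rw [hmap, Measure.smul_apply, smul_eq_mul]
  rcases le_or_gt r 0 with hr | hr
  · have h1 : radialMeasure n (Iio r) = 0 := by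
      refine measure_mono_null (Iio_subset_Iio hr) ?_
      rw [radialMeasure_Iio hn le_rfl zero_le_one, zero_pow (realDim_pos hn).ne']
      simp
    rw [h1, ball_eq_empty.2 hr]
    simp
  rcases le_or_gt r 1 with hr1 | hr1
  · rw [hsmall r hr hr1, Measure.addHaar_smul, radialMeasure_Iio hn hr.le hr1, mul_comm,
      abs_of_nonneg (by positivity)]
    rfl
  · rw [radialMeasure_of_Iio_subset hn measurableSet_Iio (Iio_subset_Iio hr1.le), mul_one]
    congr 1
    refine inter_eq_right.2 (inter_subset_right.trans ?_)
    exact ball_subset_ball hr1.le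

/-- The radial part `∫_x^1 ω(t) d t^{d-1} dt` of the weight of a block. -/
def radialTail (n : ℕ) (ω : ℝ → ℝ) (x : ℝ) : ℝ≥0∞ :=
  ∫⁻ t in Ioo x 1, ENNReal.ofReal (ω t) ∂(radialMeasure n)

theorem IsRadialWeight.aemeasurable_Ioo (hω : IsRadialWeight n ω) :
    AEMeasurable (fun t => ENNReal.ofReal (ω t)) (volume.restrict (Ioo (0 : ℝ) 1)) :=
  (hω.aemeasurable.mono_measure (Measure.restrict_mono Ioo_subset_Ico_self le_rfl)).ennreal_ofReal

/-- The weight of a truncated sector splits into an angular and a radial part. -/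
theorem weightMeasure_sector (hn : 1 ≤ n) (hω : IsRadialWeight n ω) (ξ : Cn n) (s x : ℝ) :
    weightMeasure n ω (norm ⁻¹' Ioo x 1 ∩ sector ξ s) =
      (volume (unitBall n))⁻¹ * (volume (sector ξ s ∩ unitBall n) * radialTail n ω x) := by
  have hm1 : MeasurableSet (norm ⁻¹' Ioo x 1 : Set (Cn n)) := measurable_norm measurableSet_Ioo
  have hm := hm1.inter (measurableSet_sector ξ s)
  have hset : norm ⁻¹' Ioo x 1 ∩ sector ξ s ∩ unitBall n =
      norm ⁻¹' Ioo x 1 ∩ (sector ξ s ∩ unitBall n) := inter_assoc _ _ _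
  rw [weightMeasure, withDensity_apply _ hm, normVolume, Measure.restrict_smul,
    lintegral_smul_measure, smul_eq_mul, Measure.restrict_restrict hm, hset,
    ← Measure.restrict_restrict hm1]
  congr 1
  rw [radialTail, ← smul_eq_mul, ← lintegral_smul_measure, ← Measure.restrict_smul,
    ← map_norm_volume_sector hn, Measure.restrict_map measurable_norm measurableSet_Ioo,
    lintegral_map' _ measurable_norm.aemeasurable]
  rw [← Measure.restrict_map measurable_norm measurableSet_Ioo, map_norm_volume_sector hn]
  refine (hω.aemeasurable_Ioo.mono_ac ?_)
  refine Measure.restrict_le_self.absolutelyContinuous.trans ?_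
  exact Measure.smul_absolutelyContinuous.trans (withDensity_absolutelyContinuous _ _)

theorem radialTail_eq (hω : IsRadialWeight n ω) {x : ℝ} (hx : 0 ≤ x) :
    radialTail n ω x = ∫⁻ t in Ioo x 1,
      ENNReal.ofReal (realDim n * t ^ (realDim n - 1)) * ENNReal.ofReal (ω t) := by
  rw [radialTail, radialMeasure, restrict_withDensity measurableSet_Ioo,
    Measure.restrict_restrict measurableSet_Ioo, inter_eq_left.2 (Ioo_subset_Ioo_left hx),
    lintegral_withDensity_eq_lintegral_mul₀ (by fun_prop)]
  · rfl
  · exact hω.aemeasurable_Ioo.mono_measure (Measure.restrict_mono (Ioo_subset_Ioo_left hx) le_rfl)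

/-! ### Doubling and positivity of the radial and angular factors -/

theorem tail_antitone (ω : ℝ → ℝ) : Antitone (tail ω) := fun _ _ h =>
  lintegral_mono_set (Ioo_subset_Ioo_left h)

theorem radialTail_antitone (n : ℕ) (ω : ℝ → ℝ) : Antitone (radialTail n ω) := fun _ _ h =>
  lintegral_mono_set (Ioo_subset_Ioo_left h)

theorem radialTail_le (hω : IsRadialWeight n ω) {x : ℝ} (hx : 0 ≤ x) :
    radialTail n ω x ≤ ENNReal.ofReal (realDim n) * tail ω x := by
  rw [radialTail_eq hω hx, tail, ← lintegral_const_mul' _ _ ENNReal.ofReal_ne_top]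
  refine setLIntegral_mono' measurableSet_Ioo fun t ht => ?_
  gcongr
  have h0 : 0 ≤ t := hx.trans ht.1.le
  have : t ^ (realDim n - 1) ≤ 1 := pow_le_one₀ h0 ht.2.le
  nlinarith [Nat.cast_nonneg (α := ℝ) (realDim n)]

/-- The density `d t^(d-1)` degenerates at the origin. Moving to the midpoint `(1 + x)/2 ≥ 1/2`
bounds it below, at the price of one more doubling step later. -/
theorem le_radialTail (hω : IsRadialWeight n ω) {x : ℝ} (hx : 0 ≤ x) (hx1 : x < 1) :
    ENNReal.ofReal (realDim n * (1 / 2) ^ (realDim n - 1)) * tail ω ((1 + x) / 2) ≤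
      radialTail n ω x := by
  refine le_trans ?_ (radialTail_antitone n ω (show x ≤ (1 + x) / 2 by linarith))
  rw [radialTail_eq hω (by linarith), tail, ← lintegral_const_mul' _ _ ENNReal.ofReal_ne_top]
  refine setLIntegral_mono' measurableSet_Ioo fun t ht => ?_
  have : 1 / 2 ≤ t := by linarith [ht.1]
  gcongr

/-- One use of the hypothesis doubles the distance to `1`; the truncation at `0` covers the case
where that distance would exceed `1`. -/
theorem tail_doubling_iterate {C : ℝ≥0}
    (hC : ∀ r ∈ Ico (0 : ℝ) 1, tail ω r ≤ C * tail ω ((1 + r) / 2)) (k : ℕ) {x : ℝ} (hx : 0 < x) :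
    tail ω (max (1 - 2 ^ k * x) 0) ≤ (C : ℝ≥0∞) ^ k * tail ω (max (1 - x) 0) := by
  induction k with
  | zero => simp
  | succ k ih =>
    have hy : 0 < 2 ^ k * x := by positivity
    rw [pow_succ (C : ℝ≥0∞), mul_comm ((C : ℝ≥0∞) ^ k), mul_assoc,
      show (2 : ℝ) ^ (k + 1) * x = 2 * (2 ^ k * x) by ring]
    refine le_trans ?_ (mul_le_mul_right ih _)
    generalize (2 : ℝ) ^ k * x = y at hy
    rcases le_or_gt (2 * y) 1 with h | h
    · rw [max_eq_left (by linarith), max_eq_left (by linarith)]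
      have := hC (1 - 2 * y) ⟨by linarith, by linarith⟩
      rwa [show (1 + (1 - 2 * y)) / 2 = 1 - y by ring] at this
    · rw [max_eq_right (by linarith : 1 - 2 * y ≤ 0)]
      refine (hC 0 ⟨le_rfl, one_pos⟩).trans ?_
      gcongr
      apply tail_antitone
      exact max_le (by linarith) (by norm_num)

/-- The strictness of the doubling inequality suffices: a vanishing tail at the midpoint would make
its right-hand side `0`. -/
theorem IsDoublingWeight.tail_pos (hω : IsDoublingWeight n ω) {x : ℝ} (hx : x < 1) :
    0 < tail ω x := by
  obtain ⟨C, hC⟩ := hω.doubling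
  have h1 := hC (max (2 * x - 1) 0) ⟨le_max_right _ _, max_lt (by linarith) one_pos⟩
  have h2 : tail ω ((1 + max (2 * x - 1) 0) / 2) ≤ tail ω x := by
    apply tail_antitone
    linarith [le_max_left (2 * x - 1) 0]
  rw [pos_iff_ne_zero]
  intro h
  rw [h, nonpos_iff_eq_zero] at h2
  rw [h2, mul_zero] at h1
  exact not_lt_zero h1

theorem IsDoublingWeight.radialTail_pos (hn : 1 ≤ n) (hω : IsDoublingWeight n ω) {x : ℝ}
    (hx : 0 ≤ x) (hx1 : x < 1) : 0 < radialTail n ω x := by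
  refine lt_of_lt_of_le ?_ (le_radialTail hω.toIsRadialWeight hx hx1)
  refine ENNReal.mul_pos ?_ (hω.tail_pos (by linarith)).ne'
  have := realDim_pos hn
  rw [ne_eq, ENNReal.ofReal_eq_zero, not_le]
  positivity

theorem IsDoublingWeight.radialTail_doubling (hn : 1 ≤ n) (hω : IsDoublingWeight n ω) :
    ∃ D : ℝ≥0, ∀ h : ℝ, 0 < h → h ≤ 1 →
      radialTail n ω (max (1 - 32 * h) 0) ≤ D * radialTail n ω (1 - h) := by
  obtain ⟨C, hC⟩ := hω.doubling
  have hd := realDim_pos hn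
  set c : ℝ := realDim n * (1 / 2) ^ (realDim n - 1) with hc
  have hcpos : 0 < c := by positivity
  refine ⟨(realDim n : ℝ≥0) * C ^ 6 * (Real.toNNReal c)⁻¹, fun h h0 h1 => ?_⟩
  -- Five doublings account for the factor `32`, the sixth for the midpoint in `le_radialTail`.
  have e1 := tail_doubling_iterate (fun r hr => (hC r hr).le) 6 (half_pos h0)
  rw [show (2 : ℝ) ^ 6 * (h / 2) = 32 * h by ring, max_eq_left (by linarith : 0 ≤ 1 - h / 2)] at e1
  have e2 := le_radialTail (x := 1 - h) hω.toIsRadialWeight (by linarith) (by linarith)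
  rw [show (1 + (1 - h)) / 2 = 1 - h / 2 by ring, ← hc] at e2
  have hc' : ((Real.toNNReal c : ℝ≥0) : ℝ≥0∞) ≠ 0 := by simpa using hcpos
  have e3 : tail ω (1 - h / 2) ≤ ((Real.toNNReal c)⁻¹ : ℝ≥0) * radialTail n ω (1 - h) := by
    rw [ENNReal.coe_inv (by simpa using hcpos), ← ENNReal.div_eq_inv_mul, ENNReal.le_div_iff_mul_le
      (Or.inl hc') (Or.inl ENNReal.coe_ne_top), mul_comm]
    exact e2
  calc radialTail n ω (max (1 - 32 * h) 0)
      ≤ ENNReal.ofReal (realDim n) * tail ω (max (1 - 32 * h) 0) :=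
        radialTail_le hω.toIsRadialWeight (le_max_right _ _)
    _ ≤ ENNReal.ofReal (realDim n) * ((C : ℝ≥0∞) ^ 6 *
          (((Real.toNNReal c)⁻¹ : ℝ≥0) * radialTail n ω (1 - h))) := by
        gcongr
        exact e1.trans (by gcongr)
    _ = _ := by
        rw [ENNReal.ofReal_natCast]
        push_cast
        ring

theorem volume_unitBall_ne_zero (n : ℕ) : volume (unitBall n) ≠ 0 :=
  (measure_ball_pos _ _ one_pos).ne'

theorem volume_unitBall_ne_top (n : ℕ) : volume (unitBall n) ≠ ∞ := measure_ball_lt_top.ne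

theorem weightMeasure_absolutelyContinuous (n : ℕ) (ω : ℝ → ℝ) :
    weightMeasure n ω ≪ volume :=
  (withDensity_absolutelyContinuous _ _).trans
    (Measure.smul_absolutelyContinuous.trans Measure.restrict_le_self.absolutelyContinuous)

/-- The ball is, up to the null set `{0}`, a sector of aperture at least `2` in any direction. The
form `32 * 1` matches `volume_sector_le` at `s = 1`, so that `S_0` can serve as an enlargement. -/
theorem weightMeasure_unitBall (hn : 1 ≤ n) (hω : IsRadialWeight n ω) {ξ : Cn n} (hξ : ‖ξ‖ = 1) :
    weightMeasure n ω (unitBall n) = (volume (unitBall n))⁻¹ *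
      (volume (sector ξ (32 * 1) ∩ unitBall n) * radialTail n ω 0) := by
  rw [← weightMeasure_sector hn hω ξ, sector_eq_of_two_le hξ (by norm_num)]
  have := nontrivial_Cn hn
  have hnull : weightMeasure n ω {0} = 0 :=
    weightMeasure_absolutelyContinuous n ω (measure_singleton _)
  have : norm ⁻¹' Ioo 0 1 ∩ {0}ᶜ = unitBall n \ {0} := by
    ext z
    simp only [mem_inter_iff, mem_preimage, mem_Ioo, mem_compl_iff, mem_singleton_iff, mem_sdiff,
      mem_unitBall, norm_pos_iff]
    tauto
  rw [this, measure_sdiff_null hnull]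

/-- Doubling, read backwards, carries positivity from the full ball down to the apertures `32^(-k)`.
-/
theorem volume_sector_pos {ξ : Cn n} (hn : 1 ≤ n) (hξ : ‖ξ‖ = 1) {s : ℝ} (hs : 0 < s) :
    0 < volume (sector ξ s ∩ unitBall n) := by
  have hstep : ∀ k : ℕ, 0 < volume (sector ξ ((32 : ℝ)⁻¹ ^ k) ∩ unitBall n) := by
    intro k
    have hgo : ∀ t : ℝ, 0 < t → t ≤ 1 → 0 < volume (sector ξ (32 * t) ∩ unitBall n) →
        0 < volume (sector ξ t ∩ unitBall n) := by
      intro t h0 h1 h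
      have := h.trans_le (volume_sector_le hξ h0 h1)
      rw [pos_iff_ne_zero] at this ⊢
      exact right_ne_zero_of_mul this
    induction k with
    | zero =>
      apply hgo _ (by norm_num) (by norm_num)
      rw [sector_eq_of_two_le hξ (by norm_num)]
      have := nontrivial_Cn hn
      rw [inter_comm, ← sdiff_eq, measure_sdiff_null (measure_singleton _), pos_iff_ne_zero]
      exact volume_unitBall_ne_zero n
    | succ k ih =>
      apply hgo _ (by positivity) (pow_le_one₀ (by norm_num) (by norm_num))
      rwa [show (32 : ℝ) * 32⁻¹ ^ (k + 1) = 32⁻¹ ^ k by rw [pow_succ]; ring]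
  obtain ⟨k, hk⟩ := exists_pow_lt_of_lt_one hs (show (32 : ℝ)⁻¹ < 1 by norm_num)
  refine (hstep k).trans_le (measure_mono ?_)
  rintro z ⟨⟨h1, h2⟩, h3⟩
  exact ⟨⟨h1, h2.trans (by gcongr)⟩, h3⟩

end CarlesonBlock
end

/-! ### Enlargement of blocks -/

noncomputable section
namespace CarlesonBlock

variable {n : ℕ} {ω : ℝ → ℝ}

theorem IsRadialWeight.isFiniteMeasure (hω : IsRadialWeight n ω) :
    IsFiniteMeasure (weightMeasure n ω) :=
  isFiniteMeasure_withDensity_ofReal hω.integrable.2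

theorem exists_norm_eq_one (hn : 1 ≤ n) : ∃ ξ : Cn n, ‖ξ‖ = 1 := by
  have := nontrivial_Cn hn
  exact exists_norm_eq (Cn n) zero_le_one

theorem weightMeasure_block (hn : 1 ≤ n) (hω : IsRadialWeight n ω) {a : Cn n} (ha : a ≠ 0)
    (ha1 : ‖a‖ < 1) :
    weightMeasure n ω (block a) = (volume (unitBall n))⁻¹ *
      (volume (sector ((‖a‖⁻¹ : ℝ) • a) (1 - ‖a‖) ∩ unitBall n) * radialTail n ω ‖a‖) := by
  rw [block_eq ha ha1.le, weightMeasure_sector hn hω]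

theorem IsDoublingWeight.weightMeasure_block_pos (hn : 1 ≤ n) (hω : IsDoublingWeight n ω)
    {a : Cn n} (ha1 : a ∈ unitBall n) : 0 < weightMeasure n ω (block a) := by
  have hinv : (volume (unitBall n))⁻¹ ≠ 0 := ENNReal.inv_ne_zero.2 (volume_unitBall_ne_top n)
  rw [mem_unitBall] at ha1
  by_cases ha : a = 0
  · obtain ⟨ξ, hξ⟩ := exists_norm_eq_one hn
    rw [ha, block_zero, weightMeasure_unitBall hn hω.toIsRadialWeight hξ]
    exact ENNReal.mul_pos hinv (ENNReal.mul_pos (volume_sector_pos hn hξ (by norm_num)).ne'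
      (hω.radialTail_pos hn le_rfl one_pos).ne').ne'
  · rw [weightMeasure_block hn hω.toIsRadialWeight ha ha1]
    exact ENNReal.mul_pos hinv (ENNReal.mul_pos
      (volume_sector_pos hn (norm_unit_direction ha) (by linarith)).ne'
      (hω.radialTail_pos hn (norm_nonneg a) ha1).ne').ne'

theorem norm_one_sub_inner_comm (x y : Cn n) : ‖1 - inner ℂ x y‖ = ‖1 - inner ℂ y x‖ := by
  rw [← inner_conj_symm x y, ← Complex.norm_conj, map_sub, map_one, Complex.conj_conj]

/-- If two blocks meet, the one of comparable or smaller size lies in a fixed enlargement of the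
other. -/
theorem block_subset_enlargement {a b z : Cn n} (ha : a ≠ 0) (hb : b ≠ 0) (ha1 : ‖a‖ < 1)
    (hb1 : ‖b‖ < 1) (hab : 1 - ‖a‖ ≤ 2 * (1 - ‖b‖)) (hne : (block a ∩ block b).Nonempty)
    (hz : z ∈ block a) : z ∈ sector ((‖b‖⁻¹ : ℝ) • b) (32 * (1 - ‖b‖)) := by
  obtain ⟨y, hya, hyb⟩ := hne
  rw [block_eq ha ha1.le] at hya hz
  rw [block_eq hb hb1.le] at hyb
  have hz0 : z ≠ 0 := hz.2.1
  have hy0 : y ≠ 0 := hya.2.1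
  have e1 := (mem_sector_iff hz0).1 hz.2
  have e2 := (mem_sector_iff hy0).1 hya.2
  have e3 := (mem_sector_iff hy0).1 hyb.2
  rw [mem_sector_iff hz0]
  have nb := norm_unit_direction hb
  have na := norm_unit_direction ha
  have nz := norm_unit_direction hz0
  have ny := norm_unit_direction hy0
  set a' := (‖a‖⁻¹ : ℝ) • a
  set b' := (‖b‖⁻¹ : ℝ) • b
  set z' := (‖z‖⁻¹ : ℝ) • z
  set y' := (‖y‖⁻¹ : ℝ) • y
  set h := 1 - ‖b‖
  have h0 : 0 ≤ h := by simp only [h]; linarith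
  set r := Real.sqrt h
  have hr : r ^ 2 = h := Real.sq_sqrt h0
  have hr0 : 0 ≤ r := Real.sqrt_nonneg h
  -- Here `√2 < 3/2`. The chain `b, y, a, z` then has length at most `r + 3r/2 + 3r/2 = 4r`, and
  -- `16h ≤ 32h`.
  have hbig : ∀ x : ℝ, x ≤ 1 - ‖a‖ → Real.sqrt x ≤ 3 / 2 * r := by
    intro x hx
    apply Real.sqrt_le_iff.2
    exact ⟨by positivity, by nlinarith⟩
  have f1 := hbig _ e1
  have f2 := hbig _ e2
  have f3 : Real.sqrt ‖1 - inner ℂ b' y'‖ ≤ r := Real.sqrt_le_sqrt e3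
  rw [norm_one_sub_inner_comm] at f2
  have t1 := sqrt_norm_one_sub_inner_triangle nb nz ny
  have t2 := sqrt_norm_one_sub_inner_triangle ny nz na
  have t3 : Real.sqrt ‖1 - inner ℂ b' z'‖ ≤ 4 * r := by linarith
  have t4 := (Real.sqrt_le_left (by positivity)).1 t3
  nlinarith

/-- Every block has an enlargement of comparable weight, again a block, which contains all blocks
of at most twice its size that meet it. -/
theorem IsDoublingWeight.exists_enlargement (hn : 1 ≤ n) (hω : IsDoublingWeight n ω) :
    ∃ D : ℝ≥0, ∀ b ∈ unitBall n, ∃ c ∈ unitBall n,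
      weightMeasure n ω (block c) ≤ D * weightMeasure n ω (block b) ∧
      ∀ a ∈ unitBall n, 1 - ‖a‖ ≤ 2 * (1 - ‖b‖) → (block a ∩ block b).Nonempty →
        block a ⊆ block c := by
  obtain ⟨D, hD⟩ := hω.radialTail_doubling hn
  have hr := hω.toIsRadialWeight
  set K : ℝ≥0 := Real.toNNReal |(256 : ℝ) ^ Module.finrank ℝ (Cn n)| with hK
  have hK1 : 1 ≤ K := by
    rw [hK, Real.one_le_toNNReal, abs_of_nonneg (by positivity)]
    exact one_le_pow₀ (by norm_num)
  have hsec : ∀ ξ : Cn n, ‖ξ‖ = 1 → ∀ s : ℝ, 0 < s → s ≤ 1 →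
      volume (sector ξ (32 * s) ∩ unitBall n) ≤ K * volume (sector ξ s ∩ unitBall n) :=
    fun ξ hξ s hs hs1 => volume_sector_le hξ hs hs1
  have hmono : ∀ ξ : Cn n, ∀ s t : ℝ, s ≤ t →
      volume (sector ξ s ∩ unitBall n) ≤ volume (sector ξ t ∩ unitBall n) := by
    intro ξ s t hst
    refine measure_mono (inter_subset_inter_left _ ?_)
    exact fun z hz => ⟨hz.1, hz.2.trans (by gcongr)⟩
  -- One `K` suffices for a proper enlargement. When the enlargement is the whole ball, two are
  -- needed: from aperture `1 - |b|` to `1`, and from `1` to `32`.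
  refine ⟨max 1 (K * K * D), fun b hb => ?_⟩
  have hb1 := mem_unitBall.1 hb
  by_cases hb0 : b = 0
  · refine ⟨0, mem_unitBall.2 (by simp), ?_, fun a _ _ _ => ?_⟩
    · rw [hb0]
      refine le_mul_of_one_le_left zero_le ?_
      exact_mod_cast le_max_left _ _
    · rw [block_zero]; exact block_subset_unitBall a
  have hξ := norm_unit_direction hb0
  set ξ := (‖b‖⁻¹ : ℝ) • b with hξdef
  have hbpos : 0 < ‖b‖ := norm_pos_iff.2 hb0
  have hDb := hD (1 - ‖b‖) (by linarith) (by linarith)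
  rw [sub_sub_cancel] at hDb
  have hfinal : ∀ X Y : ℝ≥0∞, X ≤ K * K * volume (sector ξ (1 - ‖b‖) ∩ unitBall n) →
      Y ≤ D * radialTail n ω ‖b‖ → (volume (unitBall n))⁻¹ * (X * Y) ≤
        ((max 1 (K * K * D) : ℝ≥0) : ℝ≥0∞) * weightMeasure n ω (block b) := by
    intro X Y hX hY
    calc (volume (unitBall n))⁻¹ * (X * Y) ≤ (volume (unitBall n))⁻¹ *
          ((K * K * volume (sector ξ (1 - ‖b‖) ∩ unitBall n)) * (D * radialTail n ω ‖b‖)) := by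
          gcongr
      _ = ((K * K * D : ℝ≥0) : ℝ≥0∞) * weightMeasure n ω (block b) := by
        rw [weightMeasure_block hn hr hb0 hb1]
        push_cast
        ring
      _ ≤ _ := by
        gcongr
        exact le_max_right _ _
  rcases le_or_gt 1 (32 * (1 - ‖b‖)) with hbig | hsmall
  · refine ⟨0, mem_unitBall.2 (by simp), ?_, fun a _ _ _ => ?_⟩
    swap
    · rw [block_zero]; exact block_subset_unitBall a
    rw [block_zero, weightMeasure_unitBall hn hr hξ]
    rw [max_eq_right (by linarith)] at hDb
    refine hfinal _ _ ?_ hDb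
    rw [mul_assoc]
    refine (hsec ξ hξ 1 one_pos le_rfl).trans ?_
    gcongr
    exact (hmono ξ _ _ hbig).trans (hsec ξ hξ _ (by linarith) (by linarith))
  · rw [max_eq_left (by linarith)] at hDb
    set t := 1 - 32 * (1 - ‖b‖) with ht
    have ht0 : 0 < t := by linarith
    have hnc : ‖t • ξ‖ = t := by rw [norm_smul, hξ, mul_one, Real.norm_of_nonneg ht0.le]
    have hc1 : ‖t • ξ‖ < 1 := by rw [hnc]; linarith
    have hc0 : t • ξ ≠ 0 := by rw [← norm_pos_iff, hnc]; exact ht0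
    have hdir : (‖t • ξ‖⁻¹ : ℝ) • t • ξ = ξ := by rw [hnc, inv_smul_smul₀ ht0.ne']
    have hrad : 1 - t = 32 * (1 - ‖b‖) := by rw [ht]; ring
    refine ⟨t • ξ, mem_unitBall.2 hc1, ?_, fun a ha hab hne z hz => ?_⟩
    · rw [weightMeasure_block hn hr hc0 hc1, hdir, hnc, hrad]
      refine hfinal _ _ ?_ hDb
      refine (hsec ξ hξ _ (by linarith) (by linarith)).trans ?_
      gcongr
      exact le_mul_of_one_le_left zero_le (by exact_mod_cast hK1)
    · have ha1 := mem_unitBall.1 ha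
      -- If `a = 0`, the size condition would give `1 ≤ 2(1 - |b|) < 1/16`.
      have ha0 : a ≠ 0 := by rw [← norm_pos_iff]; linarith
      rw [block_eq hc0 hc1.le, hdir, hnc, hrad]
      refine ⟨?_, block_subset_enlargement ha0 hb0 ha1 hb1 hab hne hz⟩
      rw [block_eq ha0 ha1.le] at hz
      exact ⟨by linarith [hz.1.1], hz.1.2⟩

end CarlesonBlock
end

/-! ### Weak and strong type estimates for an abstract Vitali basis -/

noncomputable section
namespace CarlesonBlock

/-- Write `x^s = x · x^(s-1)` and bound the second factor by the power of the whole sum. -/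
theorem tsum_rpow_le_rpow_tsum {ι : Type*} (f : ι → ℝ≥0∞) {s : ℝ} (hs : 1 ≤ s) :
    ∑' i, f i ^ s ≤ (∑' i, f i) ^ s := by
  have hsplit : ∀ x : ℝ≥0∞, x ^ s = x * x ^ (s - 1) := by
    intro x
    conv_lhs => rw [show s = 1 + (s - 1) by ring]
    rw [ENNReal.rpow_add_of_nonneg _ _ zero_le_one (by linarith), ENNReal.rpow_one]
  rw [hsplit, ← ENNReal.tsum_mul_right]
  refine ENNReal.tsum_le_tsum fun i => ?_
  rw [hsplit]
  gcongr
  exact ENNReal.le_tsum i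

/-- The maximal function of `g` with respect to the averages over the sets `S a`, `a ∈ I`. -/
def avgMaximal {X ι : Type*} [MeasurableSpace X] (ν : Measure X) (S : ι → Set X) (I : Set ι)
    (g : X → ℝ≥0∞) (z : X) : ℝ≥0∞ :=
  ⨆ a ∈ {a | a ∈ I ∧ z ∈ S a}, (ν (S a))⁻¹ * ∫⁻ x in S a, g x ∂ν

/-- A family of sets of positive measure satisfying the geometric hypotheses of the Vitali covering
argument: each set has an enlargement in the family of comparable measure. -/
structure IsVitaliBasis {X ι : Type*} [MeasurableSpace X] (ν : Measure X) (S : ι → Set X)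
    (I : Set ι) (δ : ι → ℝ) (D : ℝ≥0) : Prop where
  measurableSet : ∀ a ∈ I, MeasurableSet (S a)
  pos : ∀ a ∈ I, 0 < ν (S a)
  size_nonneg : ∀ a ∈ I, 0 ≤ δ a
  size_le : ∀ a ∈ I, δ a ≤ 1
  enlarge : ∀ b ∈ I, ∃ c ∈ I, ν (S c) ≤ D * ν (S b) ∧
    ∀ a ∈ I, δ a ≤ 2 * δ b → (S a ∩ S b).Nonempty → S a ⊆ S c

variable {X ι : Type*} [MeasurableSpace X] {ν μ : Measure X} {S : ι → Set X} {I : Set ι}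
  {δ : ι → ℝ} {D A : ℝ≥0} {s : ℝ}

/-- Weak type estimate for the maximal function under a Carleson condition. -/
theorem IsVitaliBasis.meas_lt_avgMaximal_le [IsFiniteMeasure ν] (h : IsVitaliBasis ν S I δ D)
    (hs : 1 ≤ s) (hμ : ∀ a ∈ I, μ (S a) ≤ A * ν (S a) ^ s) (g : X → ℝ≥0∞) {l : ℝ≥0∞}
    (hl0 : l ≠ 0) (hl : l ≠ ∞) :
    μ {z | l < avgMaximal ν S I g z} ≤ A * D ^ s * (l⁻¹ * ∫⁻ x, g x ∂ν) ^ s := by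
  have hs0 : 0 ≤ s := by linarith
  set t : Set ι := {a | a ∈ I ∧ l < (ν (S a))⁻¹ * ∫⁻ x in S a, g x ∂ν} with ht
  -- The ratio `2` is the one in `IsVitaliBasis.enlarge`. The selected sets are countably many,
  -- being disjoint and of positive measure for a finite measure.
  obtain ⟨u, hut, hdisj, hcov⟩ := Vitali.exists_disjoint_subfamily_covering_enlargement S t δ 2
    one_lt_two (fun a ha => h.size_nonneg a ha.1) 1 (fun a ha => h.size_le a ha.1)
    (fun a ha => nonempty_of_measure_ne_zero (h.pos a ha.1).ne')
  have huI : ∀ b : u, (b : ι) ∈ I := fun b => (hut b.2).1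
  have hpd : Pairwise (Function.onFun Disjoint fun b : u => S b) :=
    fun b b' hbb => hdisj b.2 b'.2 (fun hc => hbb (Subtype.ext hc))
  have hcount : Countable u := by
    have h1 := Measure.countable_meas_pos_of_disjoint_iUnion (μ := ν) (As := fun b : u => S b)
      (fun b => h.measurableSet _ (huI b)) hpd
    rw [show {b : u | 0 < ν (S b)} = univ from eq_univ_of_forall fun b => h.pos _ (huI b)] at h1
    exact countable_univ_iff.1 h1
  choose c hcI hcν hcS using fun b : u => h.enlarge b (huI b)
  have hsub : {z | l < avgMaximal ν S I g z} ⊆ ⋃ b : u, S (c b) := by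
    intro z hz
    simp only [avgMaximal, mem_ofPred_eq, lt_iSup_iff] at hz
    obtain ⟨a, ⟨haI, hza⟩, hal⟩ := hz
    obtain ⟨b, hb, hne, hδ⟩ := hcov a ⟨haI, hal⟩
    exact mem_iUnion.2 ⟨⟨b, hb⟩, hcS ⟨b, hb⟩ a haI hδ hne hza⟩
  have havg : ∀ b : u, ν (S b) ≤ l⁻¹ * ∫⁻ x in S b, g x ∂ν := by
    intro b
    have h1 := (hut b.2).2.le
    rw [← ENNReal.div_eq_inv_mul, ENNReal.le_div_iff_mul_le
      (Or.inl (h.pos _ (huI b)).ne') (Or.inl (measure_ne_top _ _))] at h1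
    rw [← ENNReal.div_eq_inv_mul, ENNReal.le_div_iff_mul_le (Or.inl hl0) (Or.inl hl), mul_comm]
    exact h1
  calc μ {z | l < avgMaximal ν S I g z} ≤ ∑' b : u, μ (S (c b)) :=
        (measure_mono hsub).trans (measure_iUnion_le _)
    _ ≤ ∑' b : u, A * D ^ s * (l⁻¹ * ∫⁻ x in S b, g x ∂ν) ^ s := by
        refine ENNReal.tsum_le_tsum fun b => ?_
        rw [mul_assoc, ← ENNReal.mul_rpow_of_nonneg _ _ hs0]
        refine (hμ _ (hcI b)).trans ?_
        gcongr
        refine (hcν b).trans ?_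
        gcongr
        exact havg b
    _ ≤ A * D ^ s * (∑' b : u, l⁻¹ * ∫⁻ x in S b, g x ∂ν) ^ s := by
        rw [ENNReal.tsum_mul_left]
        gcongr
        exact tsum_rpow_le_rpow_tsum _ hs
    _ ≤ _ := by
        rw [ENNReal.tsum_mul_left,
          ← lintegral_iUnion (fun b : u => h.measurableSet _ (huI b)) hpd]
        gcongr
        exact Measure.restrict_le_self

/-- Values of `g` not exceeding `l` contribute at most `l` to any average. -/
theorem avgMaximal_le_indicator_add (g : X → ℝ≥0∞) (l : ℝ≥0∞) (z : X) :
    avgMaximal ν S I g z ≤ avgMaximal ν S I ({x | l < g x}.indicator g) z + l := by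
  refine iSup₂_le fun a ha => ?_
  have h1 : ∫⁻ x in S a, g x ∂ν ≤
      (∫⁻ x in S a, {x | l < g x}.indicator g x ∂ν) + l * ν (S a) := by
    calc ∫⁻ x in S a, g x ∂ν ≤ ∫⁻ x in S a, ({x | l < g x}.indicator g x + l) ∂ν := by
          refine lintegral_mono fun x => ?_
          by_cases hx : l < g x
          · simp [indicator_of_mem (s := {x | l < g x}) hx]
          · simpa [indicator_of_notMem (s := {x | l < g x}) hx] using hx
      _ = _ := by
        rw [lintegral_add_right _ measurable_const, setLIntegral_const]
  calc (ν (S a))⁻¹ * ∫⁻ x in S a, g x ∂ν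
      ≤ (ν (S a))⁻¹ * (∫⁻ x in S a, {x | l < g x}.indicator g x ∂ν) +
          l * ((ν (S a))⁻¹ * ν (S a)) := by
        refine (mul_le_mul_right h1 _).trans_eq ?_
        ring
    _ ≤ avgMaximal ν S I ({x | l < g x}.indicator g) z + l * 1 := by
        gcongr
        · exact le_iSup₂ (f := fun a (_ : a ∈ {a | a ∈ I ∧ z ∈ S a}) =>
            (ν (S a))⁻¹ * ∫⁻ x in S a, {x | l < g x}.indicator g x ∂ν) a ha
        · exact ENNReal.inv_mul_le_one _
    _ = _ := by rw [mul_one]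

/-- The weak type estimate, with the `L^p` norm and the part of the mass of `φ` above the level. -/
theorem IsVitaliBasis.meas_lt_avgMaximal_le_withDensity [IsFiniteMeasure ν]
    (h : IsVitaliBasis ν S I δ D) (hs : 1 ≤ s) (hμ : ∀ a ∈ I, μ (S a) ≤ A * ν (S a) ^ s)
    {P : ℝ} (hP : 1 < P) (φ : X → ℝ) {t : ℝ} (ht : 0 < t) :
    μ {z | ENNReal.ofReal t < avgMaximal ν S I (fun x => ENNReal.ofReal (φ x)) z} ≤
      A * D ^ s * (∫⁻ x, ENNReal.ofReal (φ x ^ P) ∂ν) ^ (s - 1) *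
      (ENNReal.ofReal ((t / 2)⁻¹ ^ s * ((t / 2) ^ (1 - P)) ^ (s - 1)) *
        ν.withDensity (fun x => ENNReal.ofReal (φ x)) {x | t < 2 * φ x}) := by
  have hs0 : 0 ≤ s := by linarith
  have ht2 : 0 < t / 2 := by positivity
  set g : X → ℝ≥0∞ := fun x => ENNReal.ofReal (φ x) with hg
  set l := ENNReal.ofReal (t / 2) with hl
  set N := ∫⁻ x, ENNReal.ofReal (φ x ^ P) ∂ν with hN
  have hl0 : l ≠ 0 := by rw [hl, ne_eq, ENNReal.ofReal_eq_zero, not_le]; exact ht2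
  have hset : {x | l < g x} = {x | t < 2 * φ x} := by
    ext x
    simp only [mem_ofPred_eq, hl, hg]
    rw [ENNReal.ofReal_lt_ofReal_iff_of_nonneg ht2.le]
    constructor <;> intro h <;> linarith
  have hadd : l + l = ENNReal.ofReal t := by
    rw [hl, ← ENNReal.ofReal_add ht2.le ht2.le, add_halves]
  have hsub : {z | ENNReal.ofReal t < avgMaximal ν S I g z} ⊆
      {z | l < avgMaximal ν S I ({x | l < g x}.indicator g) z} := by
    intro z hz
    have h1 := lt_of_lt_of_le hz (avgMaximal_le_indicator_add g l z)
    rw [← hadd] at h1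
    exact lt_of_add_lt_add_right h1
  set J := ∫⁻ x, {x | l < g x}.indicator g x ∂ν with hJ
  have hJ1 : J ≤ ν.withDensity g {x | t < 2 * φ x} := by
    rw [← hset]
    exact (lintegral_indicator_le _ _).trans (withDensity_apply_le _ _)
  -- Chebyshev: where `φ > t/2`, one has `φ ≤ (t/2)^(1-P) φ^P` since `P > 1`.
  have hJ2 : J ≤ ENNReal.ofReal ((t / 2) ^ (1 - P)) * N := by
    rw [hN, ← lintegral_const_mul' _ _ ENNReal.ofReal_ne_top]
    refine lintegral_mono (show {x | l < g x}.indicator g ≤ fun x =>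
      ENNReal.ofReal ((t / 2) ^ (1 - P)) * ENNReal.ofReal (φ x ^ P) from
        indicator_le fun x hx => ?_)
    rw [hset] at hx
    have hx : t < 2 * φ x := hx
    have hx' : t / 2 ≤ φ x := by linarith
    have hφ : 0 < φ x := by linarith
    rw [← ENNReal.ofReal_mul (by positivity)]
    apply ENNReal.ofReal_le_ofReal
    calc φ x = φ x ^ (1 - P) * φ x ^ P := by
          rw [← Real.rpow_add hφ, sub_add_cancel, Real.rpow_one]
      _ ≤ (t / 2) ^ (1 - P) * φ x ^ P := by
          gcongr ?_ * _
          exact Real.rpow_le_rpow_of_nonpos ht2 hx' (by linarith)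
  have hJs : J ^ s ≤ (ENNReal.ofReal ((t / 2) ^ (1 - P)) * N) ^ (s - 1) *
      ν.withDensity g {x | t < 2 * φ x} := by
    conv_lhs => rw [show s = (s - 1) + 1 by ring]
    rw [ENNReal.rpow_add_of_nonneg _ _ (by linarith) zero_le_one, ENNReal.rpow_one]
    gcongr
  calc μ {z | ENNReal.ofReal t < avgMaximal ν S I g z}
      ≤ A * D ^ s * (l⁻¹ * J) ^ s := (measure_mono hsub).trans
        (h.meas_lt_avgMaximal_le hs hμ _ hl0 ENNReal.ofReal_ne_top)
    _ ≤ A * D ^ s * ((l⁻¹) ^ s * ((ENNReal.ofReal ((t / 2) ^ (1 - P)) * N) ^ (s - 1) *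
      ν.withDensity g {x | t < 2 * φ x})) := by
        rw [ENNReal.mul_rpow_of_nonneg _ _ hs0]
        gcongr
    _ = _ := by
        rw [ENNReal.mul_rpow_of_nonneg _ _ (by linarith : 0 ≤ s - 1), hl,
          ← ENNReal.ofReal_inv_of_pos ht2, ENNReal.ofReal_rpow_of_nonneg (by positivity) hs0,
          ENNReal.ofReal_rpow_of_nonneg (by positivity) (by linarith),
          ENNReal.ofReal_mul (by positivity)]
        ring

/-- The maximal function of an integrable function is finite almost everywhere. -/
theorem IsVitaliBasis.avgMaximal_ne_top [IsFiniteMeasure ν] (h : IsVitaliBasis ν S I δ D)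
    (hs : 1 ≤ s) (hμ : ∀ a ∈ I, μ (S a) ≤ A * ν (S a) ^ s) {g : X → ℝ≥0∞}
    (hg : ∫⁻ x, g x ∂ν ≠ ∞) : ∀ᵐ z ∂μ, avgMaximal ν S I g z ≠ ∞ := by
  have hs0 : 0 < s := by linarith
  rw [ae_iff]
  simp only [ne_eq, not_not]
  have hle : ∀ k : ℕ, μ {z | avgMaximal ν S I g z = ∞} ≤
      A * D ^ s * ((((k + 1 : ℕ) : ℝ≥0∞))⁻¹ * ∫⁻ x, g x ∂ν) ^ s := by
    intro k
    refine le_trans (measure_mono fun z hz => ?_)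
      (h.meas_lt_avgMaximal_le hs hμ g (l := (k + 1 : ℕ)) (by simp) (ENNReal.natCast_ne_top _))
    have hz : avgMaximal ν S I g z = ∞ := hz
    change _ < avgMaximal ν S I g z
    rw [hz]
    exact ENNReal.natCast_lt_top _
  have hlim : Filter.Tendsto (fun k : ℕ =>
      (A : ℝ≥0∞) * D ^ s * ((((k + 1 : ℕ) : ℝ≥0∞))⁻¹ * ∫⁻ x, g x ∂ν) ^ s) Filter.atTop
      (nhds (A * D ^ s * (0 * ∫⁻ x, g x ∂ν) ^ s)) := by
    refine ENNReal.Tendsto.const_mul ?_ (Or.inr ?_)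
    · refine (ENNReal.continuous_rpow_const.tendsto _).comp ?_
      refine ENNReal.Tendsto.mul_const ?_ (Or.inr hg)
      exact ENNReal.tendsto_inv_nat_nhds_zero.comp (Filter.tendsto_add_atTop_nat 1)
    · exact ENNReal.mul_ne_top ENNReal.coe_ne_top
        (ENNReal.rpow_ne_top_of_nonneg hs0.le ENNReal.coe_ne_top)
  rw [zero_mul, ENNReal.zero_rpow_of_pos hs0, mul_zero] at hlim
  exact le_antisymm (ge_of_tendsto' hlim hle) zero_le

/-- Strong type estimate for the maximal function under a Carleson condition. -/
theorem IsVitaliBasis.lintegral_avgMaximal_rpow_le [IsFiniteMeasure ν]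
    (h : IsVitaliBasis ν S I δ D) (hs : 1 ≤ s) (hμ : ∀ a ∈ I, μ (S a) ≤ A * ν (S a) ^ s)
    {P : ℝ} (hP : 1 < P) {φ : X → ℝ} (hφ0 : ∀ x, 0 ≤ φ x) (hφ : AEMeasurable φ ν)
    (hN : ∫⁻ x, ENNReal.ofReal (φ x ^ P) ∂ν ≠ ∞)
    (hM : AEMeasurable (avgMaximal ν S I fun x => ENNReal.ofReal (φ x)) μ) :
    ∫⁻ z, avgMaximal ν S I (fun x => ENNReal.ofReal (φ x)) z ^ (s * P) ∂μ ≤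
      ENNReal.ofReal (s * P * 2 ^ (s * P) / (P - 1)) * D ^ s * A *
        (∫⁻ x, ENNReal.ofReal (φ x ^ P) ∂ν) ^ s := by
  have hs0 : 0 < s := by linarith
  have hP0 : 0 < P := by linarith
  set M := avgMaximal ν S I fun x => ENNReal.ofReal (φ x) with hMdef
  set N := ∫⁻ x, ENNReal.ofReal (φ x ^ P) ∂ν with hNdef
  -- On a finite measure space `φ ≤ 1 + φ^P` is integrable. Thus the maximal function is finite
  -- `μ`-a.e., which allows the real-valued layer cake formula to be used for it.
  have hint : ∫⁻ x, ENNReal.ofReal (φ x) ∂ν ≠ ∞ := by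
    refine ne_top_of_le_ne_top (ENNReal.add_ne_top.2 ⟨measure_ne_top ν univ, hN⟩) ?_
    rw [← lintegral_one, hNdef, ← lintegral_add_left measurable_const]
    refine lintegral_mono fun x => ?_
    rw [← ENNReal.ofReal_one, ← ENNReal.ofReal_add zero_le_one (Real.rpow_nonneg (hφ0 x) _)]
    apply ENNReal.ofReal_le_ofReal
    rcases le_or_gt (φ x) 1 with h1 | h1
    · linarith [Real.rpow_nonneg (hφ0 x) P]
    · linarith [Real.self_le_rpow_of_one_le h1.le hP.le]
  have hfin := h.avgMaximal_ne_top hs hμ hint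
  set ρ := ν.withDensity fun x => ENNReal.ofReal (φ x) with hρ
  have hφρ : AEMeasurable φ ρ := hφ.mono_ac (withDensity_absolutelyContinuous _ _)
  -- layer cake for the function
  have hcake : ENNReal.ofReal (P - 1) *
      ∫⁻ t in Ioi (0 : ℝ), ρ {x | t < 2 * φ x} * ENNReal.ofReal (t ^ (P - 1 - 1)) =
      ENNReal.ofReal (2 ^ (P - 1)) * N := by
    rw [← lintegral_rpow_eq_lintegral_meas_lt_mul ρ
      (Filter.Eventually.of_forall fun x => mul_nonneg zero_le_two (hφ0 x)) (hφρ.const_mul 2)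
      (by linarith), hρ, lintegral_withDensity_eq_lintegral_mul₀ hφ.ennreal_ofReal
      (by fun_prop), hNdef, ← lintegral_const_mul' _ _ ENNReal.ofReal_ne_top]
    refine lintegral_congr fun x => ?_
    rw [Pi.mul_apply, ← ENNReal.ofReal_mul (hφ0 x), ← ENNReal.ofReal_mul (by positivity),
      Real.mul_rpow zero_le_two (hφ0 x)]
    congr 1
    have : φ x ^ P = φ x ^ (P - 1) * φ x := by
      rcases (hφ0 x).eq_or_lt with h0 | h0
      · rw [← h0, Real.zero_rpow hP0.ne', mul_zero]
      · rw [← Real.rpow_add_one h0.ne', sub_add_cancel]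
    rw [this]; ring
  have hP1 : ENNReal.ofReal (P - 1) ≠ 0 := by
    rw [ne_eq, ENNReal.ofReal_eq_zero, not_le]; linarith
  have hcake' : ∫⁻ t in Ioi (0 : ℝ), ρ {x | t < 2 * φ x} * ENNReal.ofReal (t ^ (P - 1 - 1)) =
      ENNReal.ofReal (2 ^ (P - 1) / (P - 1)) * N := by
    rw [ENNReal.ofReal_div_of_pos (by linarith), ENNReal.div_eq_inv_mul, mul_assoc, ← hcake,
      ← mul_assoc, ENNReal.inv_mul_cancel hP1 ENNReal.ofReal_ne_top, one_mul]
  calc ∫⁻ z, M z ^ (s * P) ∂μ = ∫⁻ z, ENNReal.ofReal ((M z).toReal ^ (s * P)) ∂μ := by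
        refine lintegral_congr_ae ?_
        filter_upwards [hfin] with z hz
        rw [← ENNReal.ofReal_rpow_of_nonneg ENNReal.toReal_nonneg (by positivity),
          ENNReal.ofReal_toReal hz]
    _ = ENNReal.ofReal (s * P) * ∫⁻ t in Ioi (0 : ℝ),
          μ {z | t < (M z).toReal} * ENNReal.ofReal (t ^ (s * P - 1)) :=
        lintegral_rpow_eq_lintegral_meas_lt_mul μ
          (Filter.Eventually.of_forall fun _ => ENNReal.toReal_nonneg) hM.ennreal_toReal
          (by positivity)
    _ ≤ ENNReal.ofReal (s * P) * ∫⁻ t in Ioi (0 : ℝ), A * D ^ s * N ^ (s - 1) *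
          ENNReal.ofReal (2 ^ (s * P - P + 1)) *
          (ρ {x | t < 2 * φ x} * ENNReal.ofReal (t ^ (P - 1 - 1))) := by
        gcongr ENNReal.ofReal (s * P) * ?_
        refine setLIntegral_mono' measurableSet_Ioi fun t ht => ?_
        have ht : 0 < t := ht
        have hsub : {z | t < (M z).toReal} ⊆ {z | ENNReal.ofReal t < M z} := by
          intro z hz
          exact (ENNReal.ofReal_lt_iff_lt_toReal ht.le (by
            rintro h
            have hz : t < (M z).toReal := hz
            rw [h, ENNReal.toReal_top] at hz
            linarith)).2 hz
        have hw := (measure_mono hsub).trans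
          (h.meas_lt_avgMaximal_le_withDensity hs hμ hP φ ht)
        -- The exponents `-s + (1 - P)(s - 1) + (sP - 1)` collapse to `P - 2`, independent of `s`:
        -- exactly the power in `hcake`.
        have hreal : (t / 2)⁻¹ ^ s * ((t / 2) ^ (1 - P)) ^ (s - 1) * t ^ (s * P - 1) =
            2 ^ (s * P - P + 1) * t ^ (P - 1 - 1) := by
          have ht2 : 0 < t / 2 := by positivity
          rw [Real.inv_rpow ht2.le, ← Real.rpow_neg ht2.le, ← Real.rpow_mul ht2.le,
            ← Real.rpow_add ht2, Real.div_rpow ht.le zero_le_two, div_eq_mul_inv,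
            ← Real.rpow_neg zero_le_two, mul_right_comm, ← Real.rpow_add ht, mul_comm]
          congr 2 <;> ring
        calc μ {z | t < (M z).toReal} * ENNReal.ofReal (t ^ (s * P - 1))
            ≤ _ := mul_le_mul_left hw _
          _ = A * D ^ s * N ^ (s - 1) * (ENNReal.ofReal ((t / 2)⁻¹ ^ s *
                ((t / 2) ^ (1 - P)) ^ (s - 1)) * ENNReal.ofReal (t ^ (s * P - 1))) *
                ρ {x | t < 2 * φ x} := by ring
          _ = _ := by
            rw [← ENNReal.ofReal_mul (by positivity), hreal, ENNReal.ofReal_mul (by positivity)]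
            ring
    _ = ENNReal.ofReal (s * P) * (A * D ^ s * N ^ (s - 1) *
          ENNReal.ofReal (2 ^ (s * P - P + 1)) * (ENNReal.ofReal (2 ^ (P - 1) / (P - 1)) * N)) := by
        rw [lintegral_const_mul', hcake']
        refine ENNReal.mul_ne_top (ENNReal.mul_ne_top (ENNReal.mul_ne_top ENNReal.coe_ne_top ?_)
          ?_) ENNReal.ofReal_ne_top
        · exact ENNReal.rpow_ne_top_of_nonneg hs0.le ENNReal.coe_ne_top
        · exact ENNReal.rpow_ne_top_of_nonneg (by linarith) hN
    _ = (ENNReal.ofReal (s * P) * ENNReal.ofReal (2 ^ (s * P - P + 1)) *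
          ENNReal.ofReal (2 ^ (P - 1) / (P - 1))) * D ^ s * A * (N ^ (s - 1) * N ^ (1 : ℝ)) := by
        rw [ENNReal.rpow_one]; ring
    _ = _ := by
        rw [← ENNReal.rpow_add_of_nonneg _ _ (by linarith) zero_le_one, sub_add_cancel,
          ← ENNReal.ofReal_mul (by positivity), ← ENNReal.ofReal_mul (by positivity)]
        congr 4
        have : (2 : ℝ) ^ (s * P) = 2 ^ (s * P - P + 1) * 2 ^ (P - 1) := by
          rw [← Real.rpow_add two_pos]; congr 1; ring
        rw [this]; ring

end CarlesonBlock
end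

/-! ### Blocks as a Vitali basis and measurability of the maximal function -/

noncomputable section
namespace CarlesonBlock

variable {n : ℕ} {ω : ℝ → ℝ}

theorem IsDoublingWeight.exists_isVitaliBasis (hn : 1 ≤ n) (hω : IsDoublingWeight n ω) :
    ∃ D : ℝ≥0, IsVitaliBasis (weightMeasure n ω) block (unitBall n) (fun a => 1 - ‖a‖) D := by
  obtain ⟨D, hD⟩ := hω.exists_enlargement hn
  refine ⟨D, fun a ha => measurableSet_block ha, fun a ha => hω.weightMeasure_block_pos hn ha,
    fun a ha => ?_, fun a _ => by simp, hD⟩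
  have := mem_unitBall.1 ha
  linarith

theorem mem_block_smul_iff {a z : Cn n} (ha : a ≠ 0) (ha1 : ‖a‖ ≤ 1) {t : ℝ} (ht : 0 < t)
    (ht1 : t ≤ 1) : z ∈ block (t • a) ↔ (t * ‖a‖ < ‖z‖ ∧ ‖z‖ < 1) ∧
      ‖(‖z‖ : ℂ) - inner ℂ ((‖a‖⁻¹ : ℝ) • a) z‖ ≤ (1 - t * ‖a‖) * ‖z‖ := by
  have hnorm : ‖t • a‖ = t * ‖a‖ := by rw [norm_smul, Real.norm_of_nonneg ht.le]
  have hta : t • a ≠ 0 := smul_ne_zero ht.ne' ha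
  have h0 := norm_nonneg a
  have hdir : (‖t • a‖⁻¹ : ℝ) • t • a = (‖a‖⁻¹ : ℝ) • a := by
    rw [hnorm, smul_smul, mul_inv, mul_right_comm, inv_mul_cancel₀ ht.ne', one_mul]
  rw [block_eq hta (by rw [hnorm]; nlinarith), hdir, hnorm]
  constructor
  · rintro ⟨h1, -, h2⟩
    exact ⟨h1, h2⟩
  · rintro ⟨h1, h2⟩
    refine ⟨h1, ?_, h2⟩
    rw [← norm_pos_iff]
    exact (by positivity : 0 ≤ t * ‖a‖).trans_lt h1.1

theorem block_smul_antitone {a : Cn n} (ha : a ≠ 0) (ha1 : ‖a‖ ≤ 1) {t u : ℝ} (ht : 0 < t)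
    (htu : t ≤ u) (hu : u ≤ 1) : block (u • a) ⊆ block (t • a) := by
  intro z hz
  have hz := (mem_block_smul_iff ha ha1 (ht.trans_le htu) hu).1 hz
  rw [mem_block_smul_iff ha ha1 ht (htu.trans hu)]
  have h0 : t * ‖a‖ ≤ u * ‖a‖ := by gcongr
  refine ⟨⟨h0.trans_lt hz.1.1, hz.1.2⟩, hz.2.trans ?_⟩
  gcongr

/-- The blocks decrease as the vertex moves out to `a`, and their intersection exceeds `S_a` only
within the sphere `|z| = |a|`, a null set. -/
theorem tendsto_weightMeasure_block_smul (hn : 1 ≤ n) (hω : IsRadialWeight n ω) {a : Cn n}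
    (ha : a ≠ 0) (ha1 : ‖a‖ < 1) {u : ℕ → ℝ} (hu : Monotone u) (hu0 : ∀ k, 0 < u k)
    (hu1 : ∀ k, u k < 1) (hlim : Filter.Tendsto u Filter.atTop (nhds 1)) :
    Filter.Tendsto (fun k => weightMeasure n ω (block (u k • a))) Filter.atTop
      (nhds (weightMeasure n ω (block a))) := by
  have := hω.isFiniteMeasure
  have hmem : ∀ k, u k • a ∈ unitBall n := by
    intro k
    rw [mem_unitBall, norm_smul, Real.norm_of_nonneg (hu0 k).le]
    nlinarith [hu1 k, norm_nonneg a, hu0 k]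
  have hanti : Antitone fun k => block (u k • a) := fun k m hkm =>
    block_smul_antitone ha ha1.le (hu0 k) (hu hkm) (hu1 m).le
  have hself : ∀ k, block a ⊆ block (u k • a) := by
    intro k
    have := block_smul_antitone ha ha1.le (hu0 k) (hu1 k).le le_rfl
    rwa [one_smul] at this
  have key := tendsto_measure_iInter_atTop (μ := weightMeasure n ω)
    (fun k => (measurableSet_block (hmem k)).nullMeasurableSet) hanti ⟨0, measure_ne_top _ _⟩
  have heq : weightMeasure n ω (⋂ k, block (u k • a)) = weightMeasure n ω (block a) := by
    have hnull : weightMeasure n ω (sphere 0 ‖a‖) = 0 := by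
      have := nontrivial_Cn hn
      exact weightMeasure_absolutelyContinuous n ω (Measure.addHaar_sphere _ _ _)
    refine le_antisymm ?_ (measure_mono (subset_iInter hself))
    calc weightMeasure n ω (⋂ k, block (u k • a))
        ≤ weightMeasure n ω (block a ∪ sphere 0 ‖a‖) := by
          refine measure_mono fun z hz => ?_
          have hz' := fun k => (mem_block_smul_iff ha ha1.le (hu0 k) (hu1 k).le).1
            (mem_iInter.1 hz k)
          have l1 : ‖a‖ ≤ ‖z‖ := by
            refine le_of_tendsto' (x := Filter.atTop) (f := fun k => u k * ‖a‖) ?_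
              fun k => (hz' k).1.1.le
            simpa using hlim.mul_const ‖a‖
          by_cases hzn : ‖z‖ = ‖a‖
          · right; simpa using hzn
          left
          have h1 := (mem_block_smul_iff (z := z) ha ha1.le one_pos le_rfl)
          rw [one_smul] at h1
          rw [h1, one_mul]
          refine ⟨⟨lt_of_le_of_ne l1 (Ne.symm hzn), (hz' 0).1.2⟩, ?_⟩
          refine ge_of_tendsto' (x := Filter.atTop)
            (f := fun k => (1 - u k * ‖a‖) * ‖z‖) ?_ fun k => (hz' k).2
          simpa using ((hlim.mul_const ‖a‖).const_sub 1).mul_const ‖z‖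
      _ ≤ _ := (measure_union_le _ _).trans (by rw [hnull, add_zero])
  rw [← heq]
  exact key

/-- Away from the exceptional block `S_0`, the maximal function is lower semicontinuous. -/
theorem lowerSemicontinuous_avgMaximal_block (hn : 1 ≤ n) (hω : IsRadialWeight n ω)
    (g : Cn n → ℝ≥0∞) :
    LowerSemicontinuous (avgMaximal (weightMeasure n ω) block (unitBall n \ {0}) g) := by
  have := hω.isFiniteMeasure
  intro z l hl
  simp only [avgMaximal, lt_iSup_iff] at hl
  obtain ⟨a, ⟨⟨haI, ha⟩, hza⟩, hla⟩ := hl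
  have ha : a ≠ 0 := ha
  have ha1 := mem_unitBall.1 haI
  have hapos : 0 < ‖a‖ := norm_pos_iff.2 ha
  -- Blocks are not open, so `a` is pulled slightly inward to `t • a`. The average stays above `l`,
  -- while the larger block contains a neighbourhood of `z`, all inequalities at `z` having become
  -- strict.
  obtain ⟨u, hu, hu', hlim⟩ := exists_seq_strictMono_tendsto' (show (0 : ℝ) < 1 from one_pos)
  have ht := tendsto_weightMeasure_block_smul hn hω ha ha1 hu.monotone (fun k => (hu' k).1)
    (fun k => (hu' k).2) hlim
  have ht2 : Filter.Tendsto (fun k => (weightMeasure n ω (block (u k • a)))⁻¹ *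
      ∫⁻ x in block a, g x ∂(weightMeasure n ω)) Filter.atTop
      (nhds ((weightMeasure n ω (block a))⁻¹ * ∫⁻ x in block a, g x ∂(weightMeasure n ω))) :=
    ENNReal.Tendsto.mul_const (tendsto_inv_iff.2 ht)
      (Or.inl (ENNReal.inv_ne_zero.2 (measure_ne_top _ _)))
  obtain ⟨k, hk⟩ := (ht2.eventually (lt_mem_nhds hla)).exists
  obtain ⟨t0, t1⟩ := hu' k
  set t := u k
  have hsub : block a ⊆ block (t • a) := by
    have := block_smul_antitone ha ha1.le t0 t1.le le_rfl
    rwa [one_smul] at this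
  have hlt : l < (weightMeasure n ω (block (t • a)))⁻¹ *
      ∫⁻ x in block (t • a), g x ∂(weightMeasure n ω) :=
    hk.trans_le (mul_le_mul_right (lintegral_mono_set hsub) _)
  have htI : t • a ∈ unitBall n \ {0} := by
    refine ⟨?_, smul_ne_zero t0.ne' ha⟩
    rw [mem_unitBall, norm_smul, Real.norm_of_nonneg t0.le]
    nlinarith
  have hz := (mem_block_smul_iff (z := z) ha ha1.le one_pos le_rfl).1 (by rwa [one_smul])
  rw [one_mul] at hz
  have hta : t * ‖a‖ < ‖a‖ := by nlinarith
  have hopen : ∀ᶠ w in nhds z, (t * ‖a‖ < ‖w‖ ∧ ‖w‖ < 1) ∧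
      ‖(‖w‖ : ℂ) - inner ℂ ((‖a‖⁻¹ : ℝ) • a) w‖ < (1 - t * ‖a‖) * ‖w‖ := by
    refine ((continuousAt_const.eventually_lt continuous_norm.continuousAt
      (hta.trans hz.1.1)).and (continuous_norm.continuousAt.eventually_lt continuousAt_const
      hz.1.2)).and (ContinuousAt.eventually_lt ?_ ?_ (hz.2.trans_lt ?_))
    · exact Continuous.continuousAt (by fun_prop)
    · exact Continuous.continuousAt (by fun_prop)
    · have : 0 < ‖z‖ := hapos.trans hz.1.1
      gcongr
  filter_upwards [hopen] with w hw
  have hwb : w ∈ block (t • a) := (mem_block_smul_iff ha ha1.le t0 t1.le).2 ⟨hw.1, hw.2.le⟩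
  exact hlt.trans_le (le_iSup₂ (f := fun a (_ : a ∈ {a | a ∈ unitBall n \ {0} ∧ w ∈ block a}) =>
    (weightMeasure n ω (block a))⁻¹ * ∫⁻ x in block a, g x ∂(weightMeasure n ω)) (t • a)
      ⟨htI, hwb⟩)

/-- The centre `0` has no direction along which to perturb it; its block contributes a constant on
the ball, so it is split off as a maximum. -/
theorem measurable_avgMaximal_block (hn : 1 ≤ n) (hω : IsRadialWeight n ω)
    (g : Cn n → ℝ≥0∞) :
    Measurable (avgMaximal (weightMeasure n ω) block (unitBall n) g) := by
  have heq : avgMaximal (weightMeasure n ω) block (unitBall n) g = fun z =>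
      max ((unitBall n).indicator (fun _ => (weightMeasure n ω (block 0))⁻¹ *
        ∫⁻ x in block 0, g x ∂(weightMeasure n ω)) z)
        (avgMaximal (weightMeasure n ω) block (unitBall n \ {0}) g z) := by
    funext z
    apply le_antisymm
    · refine iSup₂_le fun a ha => ?_
      by_cases ha0 : a = 0
      · subst ha0
        refine le_max_of_le_left ?_
        rw [indicator_of_mem (by simpa [block_zero] using ha.2)]
      · refine le_max_of_le_right ?_
        exact le_iSup₂ (f := fun a (_ : a ∈ {a | a ∈ unitBall n \ {0} ∧ z ∈ block a}) =>
          (weightMeasure n ω (block a))⁻¹ * ∫⁻ x in block a, g x ∂(weightMeasure n ω)) a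
          ⟨⟨ha.1, ha0⟩, ha.2⟩
    · refine max_le ?_ ?_
      · by_cases hz : z ∈ unitBall n
        · rw [indicator_of_mem hz]
          exact le_iSup₂ (f := fun a (_ : a ∈ {a | a ∈ unitBall n ∧ z ∈ block a}) =>
            (weightMeasure n ω (block a))⁻¹ * ∫⁻ x in block a, g x ∂(weightMeasure n ω)) 0
            ⟨mem_unitBall.2 (by simp), by rwa [block_zero]⟩
        · rw [indicator_of_notMem hz]; exact zero_le
      · exact biSup_mono fun a ha => ⟨ha.1.1, ha.2⟩
  rw [heq]
  exact (measurable_const.indicator measurableSet_unitBall).max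
    (lowerSemicontinuous_avgMaximal_block hn hω g).measurable

/-! ### The norm estimate, the testing argument and the conclusion -/

variable {p q α : ℝ} {μ : Measure (Cn n)}

theorem maximalFn_eq (φ : Cn n → ℝ) (hφ : ∀ z, 0 ≤ φ z) :
    maximalFn ω φ =
      avgMaximal (weightMeasure n ω) block (unitBall n) fun z => ENNReal.ofReal (φ z) := by
  have : (fun z => ENNReal.ofReal (φ z)) = fun z => ‖φ z‖ₑ := by
    funext z; rw [Real.enorm_of_nonneg (hφ z)]
  rw [this]
  rfl

theorem measurable_maximalOp (hn : 1 ≤ n) (hω : IsRadialWeight n ω) (f : Cn n → ℂ) :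
    Measurable (maximalOp ω α f) := by
  unfold maximalOp
  rw [maximalFn_eq _ fun z => Real.rpow_nonneg (norm_nonneg _) _]
  exact (measurable_avgMaximal_block hn hω _).pow_const _

theorem eLpNorm_ofReal_eq {X E : Type*} [MeasurableSpace X] [TopologicalSpace E]
    [ContinuousENorm E] (hp : 0 < p) (f : X → E) (ν : Measure X) :
    eLpNorm f (ENNReal.ofReal p) ν = (∫⁻ x, ‖f x‖ₑ ^ p ∂ν) ^ (1 / p) := by
  rw [eLpNorm_eq_lintegral_rpow_enorm_toReal (by simpa using hp) ENNReal.ofReal_ne_top,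
    ENNReal.toReal_ofReal hp.le]

/-- A Carleson condition with finite constant gives the norm estimate. -/
theorem eLpNorm_maximalOp_le {D : ℝ≥0} (hn : 1 ≤ n) (hω : IsDoublingWeight n ω)
    (hD : IsVitaliBasis (weightMeasure n ω) block (unitBall n) (fun a => 1 - ‖a‖) D)
    (hp : 0 < p) (hpq : p ≤ q) (hα : 0 < α) (hpα : 1 < p * α)
    (hfin : carlesonSup ω μ p q < ∞) {f : Cn n → ℂ} (hf : MemLpWeight ω p f) :
    eLpNorm (maximalOp ω α f) (ENNReal.ofReal q) (μ.restrict (unitBall n)) ≤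
      (ENNReal.ofReal (q * α * 2 ^ (q * α) / (p * α - 1)) * D ^ (q / p) *
        carlesonSup ω μ p q) ^ (1 / q) * eLpNorm f (ENNReal.ofReal p) (weightMeasure n ω) := by
  have hq : 0 < q := hp.trans_le hpq
  have hωr := hω.toIsRadialWeight
  have := hωr.isFiniteMeasure
  have hs : 1 ≤ q / p := (one_le_div hp).2 hpq
  set A := (carlesonSup ω μ p q).toNNReal
  have hA : (A : ℝ≥0∞) = carlesonSup ω μ p q := ENNReal.coe_toNNReal hfin.ne
  have hμ : ∀ a ∈ unitBall n, μ.restrict (unitBall n) (block a) ≤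
      A * weightMeasure n ω (block a) ^ (q / p) := by
    intro a ha
    refine (Measure.restrict_apply_le _ _).trans ?_
    have hpos := hω.weightMeasure_block_pos hn ha
    rw [hA, ← ENNReal.div_le_iff_le_mul
      (Or.inl (ENNReal.rpow_pos hpos (measure_ne_top _ _)).ne')
      (Or.inl (ENNReal.rpow_ne_top_of_nonneg (by linarith) (measure_ne_top _ _)))]
    exact le_iSup₂ (f := fun a (_ : a ∈ unitBall n) =>
      μ (block a) / weightMeasure n ω (block a) ^ (q / p)) a ha
  set φ : Cn n → ℝ := fun z => ‖f z‖ ^ (1 / α) with hφdef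
  have hφ0 : ∀ z, 0 ≤ φ z := fun z => Real.rpow_nonneg (norm_nonneg _) _
  have hφ : AEMeasurable φ (weightMeasure n ω) :=
    hf.aestronglyMeasurable.aemeasurable.norm.pow_const _
  have hpow : ∀ z, ENNReal.ofReal (φ z ^ (p * α)) = ‖f z‖ₑ ^ p := by
    intro z
    rw [hφdef, ← Real.rpow_mul (norm_nonneg _), show 1 / α * (p * α) = p by field_simp,
      ← ofReal_norm, ENNReal.ofReal_rpow_of_nonneg (norm_nonneg _) hp.le]
  have hfp := eLpNorm_ofReal_eq hp f (weightMeasure n ω)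
  have hN : ∫⁻ z, ENNReal.ofReal (φ z ^ (p * α)) ∂(weightMeasure n ω) ≠ ∞ := by
    simp_rw [hpow]
    intro h
    rw [h, ENNReal.top_rpow_of_pos (by positivity)] at hfp
    exact hf.eLpNorm_lt_top.ne hfp
  have hstrong := hD.lintegral_avgMaximal_rpow_le hs hμ hpα hφ0 hφ hN
    (measurable_avgMaximal_block hn hωr _).aemeasurable
  -- The strong type estimate is used with `s = q/p` and `P = pα`, so `sP = qα` is the exponent of
  -- `M(φ)` in `|T f|^q`.
  have hqα : q / p * (p * α) = q * α := by field_simp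
  rw [hqα, hA] at hstrong
  simp_rw [hpow] at hstrong
  rw [eLpNorm_ofReal_eq hq, hfp]
  have hT : ∀ z, ‖maximalOp ω α f z‖ₑ ^ q =
      avgMaximal (weightMeasure n ω) block (unitBall n) (fun x => ENNReal.ofReal (φ x)) z ^
        (q * α) := by
    intro z
    rw [enorm_eq_self, maximalOp, maximalFn_eq _ hφ0, ← ENNReal.rpow_mul, mul_comm]
  simp_rw [hT]
  refine (ENNReal.rpow_le_rpow hstrong (by positivity)).trans_eq ?_
  rw [ENNReal.mul_rpow_of_nonneg _ _ (by positivity : 0 ≤ 1 / q), ← ENNReal.rpow_mul]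
  congr 2
  field_simp

/-- Testing on indicators of blocks. -/
theorem carlesonSup_le_rpow (hn : 1 ≤ n) (hω : IsDoublingWeight n ω) (hp : 0 < p) (hq : 0 < q)
    (hα : 0 < α) {C : ℝ≥0∞} (hC : ∀ f : Cn n → ℂ, MemLpWeight ω p f →
      eLpNorm (maximalOp ω α f) (ENNReal.ofReal q) (μ.restrict (unitBall n)) ≤
        C * eLpNorm f (ENNReal.ofReal p) (weightMeasure n ω)) :
    carlesonSup ω μ p q ≤ C ^ q := by
  have := hω.toIsRadialWeight.isFiniteMeasure
  refine iSup₂_le fun a ha => ?_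
  have hms := measurableSet_block ha
  set f : Cn n → ℂ := (block a).indicator fun _ => 1 with hf
  have hfm : MemLpWeight ω p f :=
    memLp_indicator_const _ hms _ (Or.inr (measure_ne_top _ _))
  have hfn : eLpNorm f (ENNReal.ofReal p) (weightMeasure n ω) =
      weightMeasure n ω (block a) ^ (1 / p) := by
    rw [hf, eLpNorm_indicator_const hms (by simpa using hp) ENNReal.ofReal_ne_top,
      ENNReal.toReal_ofReal hp.le]
    simp
  have hge : ∀ z ∈ block a, 1 ≤ maximalOp ω α f z := by
    intro z hz
    have h1 : (1 : ℝ≥0∞) ≤ maximalFn ω (fun ξ => ‖f ξ‖ ^ (1 / α)) z := by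
      have h2 : ∫⁻ ξ in block a, ‖‖f ξ‖ ^ (1 / α)‖ₑ ∂(weightMeasure n ω) =
          weightMeasure n ω (block a) := by
        rw [setLIntegral_congr_fun (g := fun _ => 1) hms, setLIntegral_one]
        intro ξ hξ
        simp [hf, indicator_of_mem hξ]
      refine le_trans ?_ (le_iSup₂ (f := fun a (_ : a ∈ {a : Cn n | a ∈ unitBall n ∧ z ∈ block a}) =>
        (weightMeasure n ω (block a))⁻¹ * ∫⁻ ξ in block a, ‖‖f ξ‖ ^ (1 / α)‖ₑ
          ∂(weightMeasure n ω)) a ⟨ha, hz⟩)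
      rw [h2, ENNReal.inv_mul_cancel (hω.weightMeasure_block_pos hn ha).ne' (measure_ne_top _ _)]
    exact ENNReal.one_le_rpow h1 hα
  have hmain : μ (block a) ≤
      eLpNorm (maximalOp ω α f) (ENNReal.ofReal q) (μ.restrict (unitBall n)) ^ q := by
    rw [eLpNorm_ofReal_eq hq, ← ENNReal.rpow_mul, one_div_mul_cancel hq.ne', ENNReal.rpow_one]
    calc μ (block a) = ∫⁻ _ in block a, 1 ∂μ := (setLIntegral_one _).symm
      _ ≤ ∫⁻ z in block a, ‖maximalOp ω α f z‖ₑ ^ q ∂μ := by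
        refine setLIntegral_mono' hms fun z hz => ?_
        rw [enorm_eq_self]
        exact ENNReal.one_le_rpow (hge z hz) hq
      _ ≤ _ := lintegral_mono_set (block_subset_unitBall a)
  refine ENNReal.div_le_of_le_mul (hmain.trans ?_)
  refine (ENNReal.rpow_le_rpow (hC f hfm) hq.le).trans_eq ?_
  rw [hfn, ENNReal.mul_rpow_of_nonneg _ _ hq.le, ← ENNReal.rpow_mul, one_div_mul_eq_div]

end CarlesonBlock
end

theorem corollary3p2 (n : ℕ) (hn : 1 ≤ n) (p q α : ℝ) (hp : 0 < p) (hpq : p ≤ q)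
    (hα : 0 < α) (hpα : 1 < p * α) (ω : ℝ → ℝ) (hω : CarlesonBlock.IsDoublingWeight n ω) :
    ∃ K : ℝ≥0, 0 < K ∧ ∀ μ : Measure (CarlesonBlock.Cn n),
      (CarlesonBlock.IsBoundedOp ω μ p q α ↔ CarlesonBlock.carlesonSup ω μ p q < ∞) ∧
      CarlesonBlock.opNorm ω μ p q α ^ q ≤ K * CarlesonBlock.carlesonSup ω μ p q ∧
      CarlesonBlock.carlesonSup ω μ p q ≤ K * CarlesonBlock.opNorm ω μ p q α ^ q := by
  have hq : 0 < q := hp.trans_le hpq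
  obtain ⟨D, hD⟩ := hω.exists_isVitaliBasis hn
  have hDtop : ENNReal.ofReal (q * α * 2 ^ (q * α) / (p * α - 1)) * (D : ℝ≥0∞) ^ (q / p) ≠ ∞ :=
    ENNReal.mul_ne_top ENNReal.ofReal_ne_top
      (ENNReal.rpow_ne_top_of_nonneg (by positivity) ENNReal.coe_ne_top)
  set K₀ := ENNReal.ofReal (q * α * 2 ^ (q * α) / (p * α - 1)) * (D : ℝ≥0∞) ^ (q / p) with hK₀
  -- Testing needs only the constant `1`. The maximum also keeps `K` nonzero, so that `K · ∞ = ∞`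
  -- settles the upper bound when the Carleson supremum is infinite.
  refine ⟨max 1 K₀.toNNReal, by positivity, fun μ => ?_⟩
  have hK1 : (1 : ℝ≥0∞) ≤ (max 1 K₀.toNNReal : ℝ≥0) := by exact_mod_cast le_max_left _ _
  have hK2 : K₀ ≤ (max 1 K₀.toNNReal : ℝ≥0) := by
    rw [← ENNReal.coe_toNNReal hDtop]
    exact_mod_cast le_max_right _ _
  refine ⟨⟨?_, ?_⟩, ?_, ?_⟩
  · rintro ⟨C, hC⟩
    refine (CarlesonBlock.carlesonSup_le_rpow hn hω hp hq hα fun f hf => (hC f hf).2).trans_lt ?_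
    exact (ENNReal.rpow_ne_top_of_nonneg hq.le ENNReal.coe_ne_top).lt_top
  · intro hfin
    have htop : (K₀ * CarlesonBlock.carlesonSup ω μ p q) ^ (1 / q) ≠ ∞ :=
      ENNReal.rpow_ne_top_of_nonneg (by positivity) (ENNReal.mul_ne_top hDtop hfin.ne)
    refine ⟨((K₀ * CarlesonBlock.carlesonSup ω μ p q) ^ (1 / q)).toNNReal, fun f hf => ?_⟩
    rw [ENNReal.coe_toNNReal htop]
    have hle := CarlesonBlock.eLpNorm_maximalOp_le hn hω hD hp hpq hα hpα hfin hf
    refine ⟨⟨(CarlesonBlock.measurable_maximalOp hn hω.toIsRadialWeight f).aestronglyMeasurable,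
      hle.trans_lt ?_⟩, hle⟩
    exact (ENNReal.mul_ne_top htop hf.eLpNorm_lt_top.ne).lt_top
  · by_cases hfin : CarlesonBlock.carlesonSup ω μ p q < ∞
    · have h1 : CarlesonBlock.opNorm ω μ p q α ≤
          (K₀ * CarlesonBlock.carlesonSup ω μ p q) ^ (1 / q) :=
        sInf_le fun f hf => CarlesonBlock.eLpNorm_maximalOp_le hn hω hD hp hpq hα hpα hfin hf
      calc CarlesonBlock.opNorm ω μ p q α ^ q
          ≤ ((K₀ * CarlesonBlock.carlesonSup ω μ p q) ^ (1 / q)) ^ q :=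
            ENNReal.rpow_le_rpow h1 hq.le
        _ = K₀ * CarlesonBlock.carlesonSup ω μ p q := by
          rw [← ENNReal.rpow_mul, one_div_mul_cancel hq.ne', ENNReal.rpow_one]
        _ ≤ _ := by gcongr
    · rw [not_lt_top_iff.1 hfin, ENNReal.mul_top (one_pos.trans_le hK1).ne']
      exact le_top
  -- Taking the `q`-th root first makes the testing bound a lower bound for every admissible `C`,
  -- hence for the infimum, whether or not it is finite.
  · have h1 : CarlesonBlock.carlesonSup ω μ p q ^ q⁻¹ ≤ CarlesonBlock.opNorm ω μ p q α := by
      refine le_sInf fun C hC => ?_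
      rw [ENNReal.rpow_inv_le_iff hq]
      exact CarlesonBlock.carlesonSup_le_rpow hn hω hp hq hα hC
    rw [ENNReal.rpow_inv_le_iff hq] at h1
    exact h1.trans (le_mul_of_one_le_left zero_le hK1)
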